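/- **Theorem (SEM3 $\Rightarrow$ IND').** If a quantum encryption scheme (public-key or symmetric-key) is SEM3 secure, then it is IND' secure. The same holds under chosen-plaintext attacks (SEM3-CPA implies IND'-CPA) and under non-adaptive chosen-ciphertext attacks (SEM3-CCA1 implies IND'-CCA1). *Definitions.* $n$ is the security parameter. A QPT is a polynomial-time uniform family of quantum circuits indexed by $n$: some polynomial-time Turing machine, on input $1^n$, prints the $n$-th circuit. Circuits consist of the addition of ancillas $|0\rangle$, the unitary gates $X, H, T, \mathrm{CNOT}$, Toffoli, measurement gates in the computational basis, resets of a qubit to a fresh $|0\rangle$, possibly oracle gates, and a final tracing out of qubits. A function $\varepsilon(n)$ is negligible if $n^k\varepsilon(n)\to 0$ for every $k$. A quantum public-key encryption scheme consists of QPTs $\mathsf{KeyGen}: 1^n\mapsto (pk,sk)\in\mathcal K_{pub}\times\{0,1\}^n$ with $\mathcal K_{pub}\subseteq\{0,1\}^{p(n)}$; $\mathsf{Enc}$, which maps $pk$ and a state of the $m(n)$-qubit message register $M$ to a state of the $c(n)$-qubit ciphertext register; and $\mathsf{Dec}$, which maps $sk$ and a ciphertext state to a message state; such that for some negligible $\varepsilon$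 one has $\|\mathsf{Dec}_{sk}\circ\mathsf{Enc}_{pk}-\mathbb 1_M\|_\diamond\le\varepsilon(n)$ for all $(pk,sk)$ in the support of $\mathsf{KeyGen}(1^n)$. A symmetric-key scheme is the same with a single key $k=pk=sk\in\{0,1\}^n$ (and $\mathcal K_{pub}=\{0,1\}^n$). A message generator $\mathcal M$ is a QPT that on input $pk$ (in the symmetric-key case: on a blank input) outputs a state $\rho_{ME}$, where $E$ is a side-information register of $e(n)$ qubits; $\rho_E$ is the reduced state. A message generator-function pair $(\mathcal M,f)$ consists of a message generator $\mathcal M$ and a QPT $f$ with the same input as $\mathcal M$, such that for each $pk\in\mathcal K_{pub}$ the output of $f_n$ is exactly a basis state that encodes a Boolean circuit $f_{pk}$ whose number of input bits is the number of measurement gates of $\mathcal M_n$. *SEM3.* The scheme is SEM3 secure if for every QPT adversary $\mathcal A$ (with the ciphertext register and $E$ as input) there is a QPT simulator $\mathcal S$ (with input $E$) such that for all message generator-function pairs $(\mathcal M,f)$ (with the same register $E$) there is a negligible $\varepsilon$ with $$\bigl|\Pr[\mathcal A\{(\mathsf{Enc}_{pk}\otimes\mathbb 1_E)\rho_{ME}\}=f_{pk}(x)]-\Pr[\mathcal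 S(\rho_E)=f_{pk}(x)]\bigr|\le\varepsilon(n)\quad\text{for all } n,$$ where $\rho_{ME}\leftarrow\mathcal M(pk)$, $x$ is the string of results of the measurement gates of $\mathcal M$ in this run ($\rho_{ME}$ being the corresponding post-measurement output), the outputs of $\mathcal A$ and $\mathcal S$ are measured in the computational basis, and the probabilities are over $(pk,sk)\leftarrow\mathsf{KeyGen}(1^n)$ and all internal randomness. *IND'.* The scheme is IND' secure if for all QPTs $\mathcal M$ (a message generator) and $\mathcal D$ (with the ciphertext register and $E$ as input) there is a negligible $\varepsilon$ with $$\Pr[\mathcal D\{(\mathsf{Enc}_{pk}\otimes\mathbb 1_E)\rho^{(b)}_{ME}\}=b]\le\tfrac12+\varepsilon(n)\quad\text{for all } n,$$ where $\rho_{ME}\leftarrow\mathcal M(pk)$, $b$ is a uniformly random bit, $\rho^{(1)}_{ME}=\rho_{ME}$, $\rho^{(0)}_{ME}=|0\rangle\langle0|_M\otimes\rho_E$, and the probability is over $(pk,sk)\leftarrow\mathsf{KeyGen}(1^n)$, $b$, and all internal randomness. *Attack models.* In the CPA variants of both notions all the above adversaries, simulators, generators, distinguishers and function algorithms $f$ have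 oracle access to $\mathsf{Enc}_{pk}$; in the CCA1 variants $\mathcal M$ moreover has oracle access to $\mathsf{Dec}_{sk}$. -/

import Mathlib

namespace QEnc

/-! ### Registers, operators, and elementary operations -/

/-- Bitstrings of length `k`, i.e. the computational basis states of a `k`-qubit register. -/
abbrev Bits (k : ℕ) : Type := Fin k → Bool

/-- Operators on the `2 ^ k`-dimensional Hilbert space of `k` qubits. -/
abbrev QMat (k : ℕ) : Type := Matrix (Bits k) (Bits k) ℂ

/-- The basis state `|x⟩⟨x|`. -/
def ketbra {k : ℕ} (x : Bits k) : QMat k := Matrix.single x x 1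

/-- The state `|0…0⟩⟨0…0|`. -/
def zeroState (k : ℕ) : QMat k := ketbra fun _ => false

/-- `ρ ⊗ σ` on a register of `a + b` qubits. -/
def tensor {a b : ℕ} (ρ : QMat a) (σ : QMat b) : QMat (a + b) := fun s t =>
  ρ (fun i => s (Fin.castAdd b i)) (fun i => t (Fin.castAdd b i)) *
    σ (fun j => s (Fin.natAdd a j)) (fun j => t (Fin.natAdd a j))

/-- The partial trace over the first `a` qubits of a register of `a + b` qubits. -/
def traceFst {a b : ℕ} (ρ : QMat (a + b)) : QMat b := fun s t =>
  ∑ z : Bits a, ρ (Fin.append z s) (Fin.append z t)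

/-- `(Φ ⊗ 𝟙)(ρ)`, with `Φ` acting on the first `a` of `a + b` qubits. -/
def onFst {a a' b : ℕ} (Φ : QMat a → QMat a') (ρ : QMat (a + b)) : QMat (a' + b) := fun s t =>
  Φ (fun p q => ρ (Fin.append p fun j => s (Fin.natAdd a' j))
      (Fin.append q fun j => t (Fin.natAdd a' j)))
    (fun i => s (Fin.castAdd b i)) (fun i => t (Fin.castAdd b i))

/-- The reduced state on the first `u` of `w` qubits (the other qubits are traced out). -/
def keepFirst {w : ℕ} (u : ℕ) (ρ : QMat w) : QMat u := fun s t =>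
  ∑ z : {i : Fin w // u ≤ i.1} → Bool,
    ρ (fun i => if h : i.1 < u then s ⟨i.1, h⟩ else z ⟨i, not_lt.1 h⟩)
      (fun i => if h : i.1 < u then t ⟨i.1, h⟩ else z ⟨i, not_lt.1 h⟩)

/-- The probability that measuring `ρ` in the computational basis yields the bitstring `y`
(zero if `y` does not have as many bits as `ρ` has qubits). For a subnormalized `ρ` this is the
joint probability with the event that `ρ` stands for. -/
noncomputable def outProb {u : ℕ} (ρ : QMat u) (y : List Bool) : ℝ :=
  ∑ w : Bits u, if List.ofFn w = y then (ρ w w).re else 0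

/-- The trace norm `tr √(Aᴴ A)`. -/
noncomputable def traceNorm {k : ℕ} (A : QMat k) : ℝ :=
  ∑ i, Real.sqrt ((Matrix.isHermitian_conjTranspose_mul_self A).eigenvalues i)

/-- The diamond norm `sup {‖(Φ ⊗ 𝟙)(X)‖₁ : ‖X‖₁ ≤ 1}`, the auxiliary register being a copy of the
input register. -/
noncomputable def diamondNorm {a b : ℕ} (Φ : QMat a → QMat b) : ENNReal :=
  ⨆ (X : QMat (a + a)) (_ : traceNorm X ≤ 1), ENNReal.ofReal (traceNorm (onFst Φ X))

/-- `|ε|` decreases faster than every inverse polynomial. -/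
def Negligible (ε : ℕ → ℝ) : Prop :=
  Asymptotics.SuperpolynomialDecay Filter.atTop (fun n : ℕ => (n : ℝ)) ε

/-! ### Quantum circuits with oracle gates -/

/-- The unitary gates of the (finite, universal) gate set. -/
inductive UGate
  | X | H | T | CNOT | CCX

/-- The number of qubits a unitary gate acts on. -/
def UGate.arity : UGate → ℕ
  | .X => 1
  | .H => 1
  | .T => 1
  | .CNOT => 2
  | .CCX => 3

/-- The unitary matrix `|q⟩ ↦ |f q⟩`, for a permutation `f` of the basis states. -/
def permMatrix {k : ℕ} (f : Bits k → Bits k) : QMat k := fun p q => if p = f q then 1 else 0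

/-- The matrix of a unitary gate: bit flip, Hadamard, `diag(1, e^{iπ/4})`, controlled NOT, and
Toffoli gate. -/
noncomputable def UGate.matrix : (g : UGate) → QMat g.arity
  | .X => permMatrix (k := 1) fun q => ![!q 0]
  | .H => fun (p q : Bits 1) =>
      ((Real.sqrt 2)⁻¹ : ℂ) * if p 0 = true ∧ q 0 = true then -1 else 1
  | .T => fun (p q : Bits 1) =>
      if p = q then (if p 0 = true then Complex.exp (Complex.I * Real.pi / 4) else 1) else 0
  | .CNOT => permMatrix (k := 2) fun q => ![q 0, xor (q 1) (q 0)]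
  | .CCX => permMatrix (k := 3) fun q => ![q 0, q 1, xor (q 2) (q 0 && q 1)]

/-- The two oracles: encryption and decryption. -/
inductive Oracle
  | enc | dec

/-- Which oracles may be called, and how many qubits each oracle takes and returns. -/
structure Interface where
  avail : Set Oracle
  nin : Oracle → ℕ
  nout : Oracle → ℕ

/-- No oracle may be called. -/
def noOracle : Interface := ⟨∅, fun _ => 0, fun _ => 0⟩

/-- What the oracles do. -/
abbrev Interface.Impl (I : Interface) : Type := ∀ o : Oracle, QMat (I.nin o) → QMat (I.nout o)

/-- The implementation that is used where no oracle may be called. -/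
def noImpl : noOracle.Impl := fun _ => id

/-- Gates on `w` wires: a unitary gate; the replacement of a qubit by a fresh `|0⟩` (the old qubit
is traced out); a measurement gate in the computational basis; an oracle call, which consumes the
wires `ins` (they are left in state `|0⟩`) and puts the answer on the wires `outs` (whose former
contents are traced out). -/
inductive Gate (I : Interface) (w : ℕ)
  | unitary (g : UGate) (wires : Fin g.arity ↪ Fin w)
  | reset (i : Fin w)
  | measure (i : Fin w)
  | call (o : Oracle) (ho : o ∈ I.avail) (ins : Fin (I.nin o) ↪ Fin w)
      (outs : Fin (I.nout o) ↪ Fin w) (disj : ∀ i j, ins i ≠ outs j)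

/-- `U ρ Uᴴ`, where the unitary `U` acts on the given wires. -/
noncomputable def applyUnitary {k w : ℕ} (U : QMat k) (wires : Fin k ↪ Fin w) (ρ : QMat w) :
    QMat w := fun s t =>
  (U * (Matrix.of fun p q : Bits k => ρ (Function.extend wires p s) (Function.extend wires q t)) *
    U.conjTranspose) (fun i => s (wires i)) (fun i => t (wires i))

/-- Trace out wire `i` and replace it by `|0⟩`. -/
def applyReset {w : ℕ} (i : Fin w) (ρ : QMat w) : QMat w := fun s t =>
  if s i = false ∧ t i = false then
    ∑ b : Bool, ρ (Function.update s i b) (Function.update t i b)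
  else 0

/-- The unnormalized post-measurement state `P ρ P` if wire `i` is measured with result `b`. -/
def applyProj {w : ℕ} (i : Fin w) (b : Bool) (ρ : QMat w) : QMat w := fun s t =>
  if s i = b ∧ t i = b then ρ s t else 0

/-- Apply `Φ` with input wires `ins` and output wires `outs`. -/
noncomputable def applyCall {a b w : ℕ} (Φ : QMat a → QMat b) (ins : Fin a ↪ Fin w) (outs : Fin b ↪ Fin w)
    (ρ : QMat w) : QMat w := fun s t =>
  if (∀ i, s (ins i) = false) ∧ (∀ i, t (ins i) = false) then
    Φ (fun p q => ∑ z : Bits b,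
        ρ (Function.extend ins p (Function.extend outs z s))
          (Function.extend ins q (Function.extend outs z t)))
      (fun j => s (outs j)) (fun j => t (outs j))
  else 0

/-- The number of measurement gates in a list of gates. -/
def measCount {I : Interface} {w : ℕ} : List (Gate I w) → ℕ
  | [] => 0
  | .measure _ :: gs => measCount gs + 1
  | .unitary _ _ :: gs => measCount gs
  | .reset _ :: gs => measCount gs
  | .call _ _ _ _ _ :: gs => measCount gs

/-- The unnormalized state after the gates have been applied and the measurement gates have given
the results `x`, in this order. Its trace is the probability of `x`. -/
noncomputable def runGates {I : Interface} {w : ℕ} (Φ : I.Impl) :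
    List (Gate I w) → List Bool → QMat w → QMat w
  | [], [], ρ => ρ
  | [], _ :: _, _ => 0
  | .unitary g a :: gs, x, ρ => runGates Φ gs x (applyUnitary g.matrix a ρ)
  | .reset i :: gs, x, ρ => runGates Φ gs x (applyReset i ρ)
  | .measure _ :: _, [], _ => 0
  | .measure i :: gs, b :: x, ρ => runGates Φ gs x (applyProj i b ρ)
  | .call o _ ins outs _ :: gs, x, ρ => runGates Φ gs x (applyCall (Φ o) ins outs ρ)

/-- A quantum circuit with `k` input and `u` output qubits: `anc` ancillas in state `|0⟩` are added
after the input wires, the gates are applied, and all but the first `u` wires are traced out. -/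
structure Circuit (I : Interface) (k u : ℕ) where
  anc : ℕ
  gates : List (Gate I (k + anc))
  out_le : u ≤ k + anc

namespace Circuit

variable {I : Interface} {k u : ℕ}

/-- The number of measurement gates of a circuit. -/
def numMeas (C : Circuit I k u) : ℕ := measCount C.gates

/-- The subnormalized output state on input `ρ` together with the measurement results `x`. -/
noncomputable def run (C : Circuit I k u) (Φ : I.Impl) (x : Bits C.numMeas) (ρ : QMat k) :
    QMat u :=
  keepFirst u (runGates Φ C.gates (List.ofFn x) (tensor ρ (zeroState C.anc)))

/-- The admissible map implemented by a circuit. -/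
noncomputable def channel (C : Circuit I k u) (Φ : I.Impl) (ρ : QMat k) : QMat u :=
  ∑ x : Bits C.numMeas, C.run Φ x ρ

end Circuit

/-! ### Descriptions of circuits, uniform families -/

/-- The alphabet in which quantum circuits are described. -/
inductive Sym
  | tick | sep | X | H | T | CNOT | CCX | reset | measure | enc | dec

/-- A natural number in unary. -/
def natSyms (n : ℕ) : List Sym := List.replicate n Sym.tick ++ [Sym.sep]

/-- A list of wires. -/
def wireSyms {r w : ℕ} (a : Fin r → Fin w) : List Sym :=
  (List.ofFn a).flatMap fun i => natSyms i.1

def UGate.sym : UGate → Sym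
  | .X => .X
  | .H => .H
  | .T => .T
  | .CNOT => .CNOT
  | .CCX => .CCX

def Oracle.sym : Oracle → Sym
  | .enc => .enc
  | .dec => .dec

/-- The description of a gate: its name, followed by its wires. -/
def Gate.syms {I : Interface} {w : ℕ} : Gate I w → List Sym
  | .unitary g a => g.sym :: wireSyms a
  | .reset i => Sym.reset :: natSyms i.1
  | .measure i => Sym.measure :: natSyms i.1
  | .call o _ ins outs _ => o.sym :: (wireSyms ins ++ wireSyms outs)

/-- The description of a circuit: the numbers of input, ancilla and output qubits, followed by the
gates. -/
def Circuit.syms {I : Interface} {k u : ℕ} (C : Circuit I k u) : List Sym :=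
  natSyms k ++ natSyms C.anc ++ natSyms u ++ C.gates.flatMap Gate.syms

/-- A quantum polynomial-time algorithm with oracle access as specified by `I`, with `k n` input and
`u n` output qubits for the `n`-th circuit: a family of circuits for which there is a
polynomial-time Turing machine which, on input `n` in unary, prints a description of the `n`-th
circuit. -/
structure QPT (I : ℕ → Interface) (k u : ℕ → ℕ) where
  circ : ∀ n, Circuit (I n) (k n) (u n)
  uniform : Nonempty (Turing.TM2ComputableInPolyTime Computability.unaryEncodeNat
    (id : List Sym → List Sym) fun n : ℕ => (circ n).syms)

/-- The `n`-th admissible map of an algorithm without oracles. -/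
noncomputable def QPT.map {k u : ℕ → ℕ} (A : QPT (fun _ => noOracle) k u) (n : ℕ) :
    QMat (k n) → QMat (u n) :=
  (A.circ n).channel noImpl

/-! ### Boolean circuits and their descriptions -/

/-- Gates of Boolean circuits; `i` and `j` refer to earlier wires. -/
inductive BoolGate
  | const (b : Bool)
  | nand (i j : ℕ)

/-- A gate only reads wires among the first `k`. -/
def BoolGate.Valid (k : ℕ) : BoolGate → Prop
  | .const _ => True
  | .nand i j => i < k ∧ j < k

/-- The value of a gate, given the values of the earlier wires. -/
def BoolGate.eval (v : List Bool) : BoolGate → Bool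
  | .const b => b
  | .nand i j => !(v.getD i false && v.getD j false)

/-- A Boolean circuit. The wires are the inputs, numbered from `0`, followed by the outputs of the
gates; the output string is read off a list of wires. -/
structure BoolCircuit where
  inputs : ℕ
  gates : List BoolGate
  outputs : List ℕ
  gates_valid : ∀ (t : ℕ) (ht : t < gates.length), (gates[t]).Valid (inputs + t)
  outputs_valid : ∀ i ∈ outputs, i < inputs + gates.length

/-- The output string of a Boolean circuit on the input string `x`. -/
def BoolCircuit.eval (C : BoolCircuit) (x : List Bool) : List Bool :=
  let v := C.gates.foldl (fun v g => v ++ [g.eval v]) x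
  C.outputs.map fun i => v.getD i false

/-- A natural number in unary, as a bitstring. -/
def natBits (n : ℕ) : List Bool := List.replicate n true ++ [false]

def BoolGate.bits : BoolGate → List Bool
  | .const b => [false, b]
  | .nand i j => true :: (natBits i ++ natBits j)

/-- The (self-delimiting) description of a Boolean circuit as a bitstring. -/
def BoolCircuit.bits (C : BoolCircuit) : List Bool :=
  natBits C.inputs ++ natBits C.gates.length ++ C.gates.flatMap BoolGate.bits ++
    natBits C.outputs.length ++ C.outputs.flatMap natBits

/-- The bitstring `w` is the description of `C`, padded with zeros. (Padding is needed as the output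
register of a quantum circuit has a fixed length.) -/
def Describes (w : List Bool) (C : BoolCircuit) : Prop :=
  ∃ r : ℕ, w = C.bits ++ List.replicate r false

/-! ### Quantum encryption schemes -/

/-- A quantum public-key encryption scheme with `m n`-qubit plaintexts, `c n`-qubit ciphertexts,
public keys in the subset `pub n` of `{0,1}^(pkLen n)`, and secret keys in `{0,1}^n`. -/
structure QPKE where
  pkLen : ℕ → ℕ
  m : ℕ → ℕ
  c : ℕ → ℕ
  pub : ∀ n, Set (Bits (pkLen n))
  keyGen : QPT (fun _ => noOracle) (fun n => n) (fun n => pkLen n + n)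
  enc : QPT (fun _ => noOracle) (fun n => pkLen n + m n) c
  dec : QPT (fun _ => noOracle) (fun n => n + c n) m
  keyGen_pub : ∀ n (pk : Bits (pkLen n)) (sk : Bits n),
    0 < outProb (keyGen.map n (ketbra fun _ => true)) (List.ofFn pk ++ List.ofFn sk) → pk ∈ pub n
  correct : ∃ ε, Negligible ε ∧ ∀ n (pk : Bits (pkLen n)) (sk : Bits n),
    0 < outProb (keyGen.map n (ketbra fun _ => true)) (List.ofFn pk ++ List.ofFn sk) →
      diamondNorm (fun ρ : QMat (m n) =>
        dec.map n (tensor (ketbra sk) (enc.map n (tensor (ketbra pk) ρ))) - ρ) ≤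
          ENNReal.ofReal (ε n)

/-- A quantum symmetric-key encryption scheme with `m n`-qubit plaintexts, `c n`-qubit ciphertexts,
and keys in `{0,1}^n`. -/
structure QSKE where
  m : ℕ → ℕ
  c : ℕ → ℕ
  keyGen : QPT (fun _ => noOracle) (fun n => n) (fun n => n)
  enc : QPT (fun _ => noOracle) (fun n => n + m n) c
  dec : QPT (fun _ => noOracle) (fun n => n + c n) m
  correct : ∃ ε, Negligible ε ∧ ∀ n (k : Bits n),
    0 < outProb (keyGen.map n (ketbra fun _ => true)) (List.ofFn k) →
      diamondNorm (fun ρ : QMat (m n) =>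
        dec.map n (tensor (ketbra k) (enc.map n (tensor (ketbra k) ρ))) - ρ) ≤
          ENNReal.ofReal (ε n)

/-- The data on which the security games depend, common to the two kinds of schemes. Only the games
`QPKE.game` and `QSKE.game` are used. -/
structure Game where
  /-- length of the encryption key -/
  ekLen : ℕ → ℕ
  /-- the encryption keys -/
  keys : ∀ n, Set (Bits (ekLen n))
  /-- plaintext and ciphertext length -/
  m : ℕ → ℕ
  c : ℕ → ℕ
  /-- the probability of the pair (encryption key, decryption key) -/
  prob : ∀ n, Bits (ekLen n) → Bits n → ℝ
  enc : ∀ n, Bits (ekLen n) → QMat (m n) → QMat (c n)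
  dec : ∀ n, Bits n → QMat (c n) → QMat (m n)
  /-- the classical input of the message generator and of the function algorithm -/
  inLen : ℕ → ℕ
  input : ∀ n, Bits (ekLen n) → Bits (inLen n)

/-- The public-key game: the message generator receives the public key. -/
noncomputable def QPKE.game (E : QPKE) : Game where
  ekLen := E.pkLen
  keys := E.pub
  m := E.m
  c := E.c
  prob n pk sk := outProb (E.keyGen.map n (ketbra fun _ => true)) (List.ofFn pk ++ List.ofFn sk)
  enc n pk ρ := E.enc.map n (tensor (ketbra pk) ρ)
  dec n sk σ := E.dec.map n (tensor (ketbra sk) σ)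
  inLen := E.pkLen
  input _ pk := pk

/-- The symmetric-key game: the two keys coincide, and the message generator receives only a blank
input. -/
noncomputable def QSKE.game (E : QSKE) : Game where
  ekLen n := n
  keys _ := Set.univ
  m := E.m
  c := E.c
  prob n k k' :=
    if k = k' then outProb (E.keyGen.map n (ketbra fun _ => true)) (List.ofFn k) else 0
  enc n k ρ := E.enc.map n (tensor (ketbra k) ρ)
  dec n k σ := E.dec.map n (tensor (ketbra k) σ)
  inLen _ := 0
  input _ _ := Fin.elim0

/-! ### Security -/

/-- The attack models: no oracles, chosen plaintext attacks, and non-adaptive chosen ciphertext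
attacks. -/
inductive Attack
  | plain | cpa | cca1

/-- The oracles available to message generators. -/
def Attack.genOracles : Attack → Set Oracle
  | .plain => ∅
  | .cpa => {Oracle.enc}
  | .cca1 => {Oracle.enc, Oracle.dec}

/-- The oracles available to all other algorithms. -/
def Attack.oracles : Attack → Set Oracle
  | .plain => ∅
  | .cpa => {Oracle.enc}
  | .cca1 => {Oracle.enc}

namespace Game

/-- The oracle interface of the `n`-th game, with the oracles in `S` available. -/
def iface (G : Game) (S : Set Oracle) (n : ℕ) : Interface where
  avail := S
  nin
    | .enc => G.m n
    | .dec => G.c n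
  nout
    | .enc => G.c n
    | .dec => G.m n

/-- The oracles under the given keys. -/
def impl (G : Game) (S : Set Oracle) (n : ℕ) (ek : Bits (G.ekLen n)) (dk : Bits n) :
    (G.iface S n).Impl
  | .enc => G.enc n ek
  | .dec => G.dec n dk

/-- The average over the key pairs. -/
noncomputable def keyAverage (G : Game) (n : ℕ) (P : Bits (G.ekLen n) → Bits n → ℝ) : ℝ :=
  ∑ ek : Bits (G.ekLen n), ∑ dk : Bits n, G.prob n ek dk * P ek dk

/-- A message generator with side information register of `e n` qubits: its output consists of the
register `M` (the first `m n` qubits) and the register `E`. -/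
abbrev MessageGenerator (G : Game) (att : Attack) (e : ℕ → ℕ) : Type :=
  QPT (G.iface att.genOracles) G.inLen fun n => G.m n + e n

/-- An algorithm that receives a ciphertext and the register `E`, and outputs `u n` qubits. -/
abbrev Adversary (G : Game) (att : Attack) (e u : ℕ → ℕ) : Type :=
  QPT (G.iface att.oracles) (fun n => G.c n + e n) u

/-- An algorithm that receives only the register `E`, and outputs `u n` qubits. -/
abbrev Simulator (G : Game) (att : Attack) (e u : ℕ → ℕ) : Type :=
  QPT (G.iface att.oracles) e u

/-- A message generator-function pair. `fn` is the algorithm `f`, and `circuit n ek` is the Boolean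
circuit (as many inputs as the `n`-th circuit of the message generator has measurement gates) whose
description is exactly the output of `f`. -/
structure GeneratorFunctionPair (G : Game) (att : Attack) (e : ℕ → ℕ) where
  gen : G.MessageGenerator att e
  len : ℕ → ℕ
  fn : QPT (G.iface att.oracles) G.inLen len
  circuit : ∀ n, Bits (G.ekLen n) → BoolCircuit
  inputs_eq : ∀ n, ∀ ek ∈ G.keys n, (circuit n ek).inputs = (gen.circ n).numMeas
  fn_spec : ∀ n, ∀ ek ∈ G.keys n, ∀ dk : Bits n, ∃ w : Bits (len n),
    Describes (List.ofFn w) (circuit n ek) ∧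
      (fn.circ n).channel (G.impl att.oracles n ek dk) (ketbra (G.input n ek)) = ketbra w

variable {G : Game} {att : Attack} {e u : ℕ → ℕ}

/-- `Pr[𝒜((Enc ⊗ 𝟙) ρ_ME) = f(x)]`, where `x` is the string of measurement results generating
`ρ_ME`. -/
noncomputable def realSuccess (P : G.GeneratorFunctionPair att e) (A : G.Adversary att e u)
    (n : ℕ) : ℝ :=
  G.keyAverage n fun ek dk => ∑ x : Bits (P.gen.circ n).numMeas,
    outProb
      ((A.circ n).channel (G.impl att.oracles n ek dk)
        (onFst (G.enc n ek)
          ((P.gen.circ n).run (G.impl att.genOracles n ek dk) x (ketbra (G.input n ek)))))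
      ((P.circuit n ek).eval (List.ofFn x))

/-- `Pr[𝒮(ρ_E) = f(x)]`, where `x` is the string of measurement results generating `ρ_ME`. -/
noncomputable def idealSuccess (P : G.GeneratorFunctionPair att e) (S : G.Simulator att e u)
    (n : ℕ) : ℝ :=
  G.keyAverage n fun ek dk => ∑ x : Bits (P.gen.circ n).numMeas,
    outProb
      ((S.circ n).channel (G.impl att.oracles n ek dk)
        (traceFst
          ((P.gen.circ n).run (G.impl att.genOracles n ek dk) x (ketbra (G.input n ek)))))
      ((P.circuit n ek).eval (List.ofFn x))

/-- SEM3 security. -/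
def SEM3 (G : Game) (att : Attack) : Prop :=
  ∀ (e u : ℕ → ℕ) (A : G.Adversary att e u), ∃ (u' : ℕ → ℕ) (S : G.Simulator att e u'),
    ∀ P : G.GeneratorFunctionPair att e, ∃ ε, Negligible ε ∧
      ∀ n, |realSuccess P A n - idealSuccess P S n| ≤ ε n

/-- The challenge state: `ρ^(1) = ρ` and `ρ^(0) = |0⟩⟨0|_M ⊗ ρ_E`. -/
def challenge {m e : ℕ} (ρ : QMat (m + e)) : Bool → QMat (m + e)
  | true => ρ
  | false => tensor (zeroState m) (traceFst ρ)

/-- `Pr[𝒟((Enc ⊗ 𝟙) ρ^(b)) = b]` for a uniformly random bit `b`. -/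
noncomputable def guessProb (M : G.MessageGenerator att e) (D : G.Adversary att e u) (n : ℕ) : ℝ :=
  G.keyAverage n fun ek dk => ∑ b : Bool, (1 / 2 : ℝ) *
    outProb
      ((D.circ n).channel (G.impl att.oracles n ek dk)
        (onFst (G.enc n ek)
          (challenge
            ((M.circ n).channel (G.impl att.genOracles n ek dk) (ketbra (G.input n ek))) b)))
      [b]

/-- IND' security. -/
def INDPrime (G : Game) (att : Attack) : Prop :=
  ∀ (e u : ℕ → ℕ) (M : G.MessageGenerator att e) (D : G.Adversary att e u),
    ∃ ε, Negligible ε ∧ ∀ n, guessProb M D n ≤ 1 / 2 + ε n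

end Game

/-- SEM3 security (SEM3-CPA, SEM3-CCA1) of a public-key scheme. -/
def QPKE.SEM3Secure (E : QPKE) (att : Attack) : Prop := E.game.SEM3 att

/-- IND' security (IND'-CPA, IND'-CCA1) of a public-key scheme. -/
def QPKE.INDPrimeSecure (E : QPKE) (att : Attack) : Prop := E.game.INDPrime att

/-- SEM3 security (SEM3-CPA, SEM3-CCA1) of a symmetric-key scheme. -/
def QSKE.SEM3Secure (E : QSKE) (att : Attack) : Prop := E.game.SEM3 att

/-- IND' security (IND'-CPA, IND'-CCA1) of a symmetric-key scheme. -/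
def QSKE.INDPrimeSecure (E : QSKE) (att : Attack) : Prop := E.game.INDPrime att

end QEnc

namespace QEnc

open Turing TM2

/-! ### Programs for stack machines -/

/-! A distinguisher `D` is also a SEM3 adversary: use it to guess the value of the constant function
`f = 1`. SEM3 yields a simulator `S` for `D`, chosen before the generator-function pair, so the same
`S` serves for several pairs. Take the pair of the given generator `M` with `f = 1`, and the pair of
`M₀` with `f = 1`, where `M₀` runs `M` and then resets the message register
(`MessageGenerator.blank`). The real success probabilities are `p₁ = Pr[D = 1 | b = 1]` and `p₀ =
Pr[D = 1 | b = 0]` (`Valid.realSuccess_constPair`, `answerProb_blank`). The simulator sees only the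
register `E`, whose state is the same for `M` and `M₀`, so its success probabilities agree
(`idealSuccess_constPair_blank`). Hence `p₁ - p₀ ≤ ε₁ + ε₀`. Since `Pr[D = 0 | b = 0] ≤ 1 - p₀`, the
guessing probability is at most `1/2 + (p₁ - p₀)/2`. This is `Valid.indPrime_of_sem3`; it covers
both kinds of schemes and all attack models at once.

Most of the work is to see that `M₀` and the algorithm for `f` are uniform. To append the resets, a
machine must know the message length `m n`; it is the third number in the description of the
decryption circuit. To write a description of the constant Boolean circuit, it must know the number
of measurement gates of `M`, and counts them in the description of `M`. Both are programs reading
the outputs of given machines; `PolyTime.combine` turns such a program, if its time is polynomial in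
the lengths of these outputs, into a single polynomial-time machine. The programs are built from
composable fragments with proved time bounds and analysed in `runs_appendResets` and
`runs_describeConst`.

The other ingredient is that every circuit implements a completely positive trace-preserving map
(`Circuit.isChannel_channel`). Additivity lets the sum over measurement results pass through
encryption and `D`; positivity and trace preservation bound the answer probabilities of `D`. -/

noncomputable instance : Fintype Sym := by
  classical
  exact ⟨{.tick, .sep, .X, .H, .T, .CNOT, .CCX, .reset, .measure, .enc, .dec}, by
    intro x; cases x <;> simp⟩

/-! ### Embedding the statements of one machine into another -/

section Embedding

variable {K₁ K₂ : Type} [DecidableEq K₁] [DecidableEq K₂] {Γ : K₂ → Type} {σ₁ σ₂ Λ₁ Λ₂ : Type}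

/-- The statement `q` carried out on the stacks `ι k` and on the part of the internal state that
`get` and `set` access. Jumps are redirected by `g`, and instead of halting one jumps to `quit`. -/
def embedStmt (ι : K₁ → K₂) (get : σ₂ → σ₁) (set : σ₂ → σ₁ → σ₂) (g : Λ₁ → Λ₂) (quit : Λ₂) :
    Stmt (fun k => Γ (ι k)) Λ₁ σ₁ → Stmt Γ Λ₂ σ₂
  | .push k f q => .push (ι k) (fun v => f (get v)) (embedStmt ι get set g quit q)
  | .peek k f q => .peek (ι k) (fun v a => set v (f (get v) a)) (embedStmt ι get set g quit q)
  | .pop k f q => .pop (ι k) (fun v a => set v (f (get v) a)) (embedStmt ι get set g quit q)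
  | .load f q => .load (fun v => set v (f (get v))) (embedStmt ι get set g quit q)
  | .branch f q q' => .branch (fun v => f (get v)) (embedStmt ι get set g quit q)
      (embedStmt ι get set g quit q')
  | .goto f => .goto fun v => g (f (get v))
  | .halt => .goto fun _ => quit

/-- The embedded statement acts only through `ι`, `get` and `set`, so it simulates the original and
leaves the other stacks alone. The rest of the internal state is not tracked, since later fragments
work from any initial state. -/
theorem embedStmt_stepAux {ι : K₁ → K₂} (hι : Function.Injective ι) {get : σ₂ → σ₁}
    {set : σ₂ → σ₁ → σ₂} (hgs : ∀ v a, get (set v a) = a) (g : Λ₁ → Λ₂) (quit : Λ₂)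
    (q : Stmt (fun k => Γ (ι k)) Λ₁ σ₁) (v₂ : σ₂) (S₂ : ∀ k, List (Γ k)) :
    ∃ v S, stepAux (embedStmt ι get set g quit q) v₂ S₂ =
        ⟨some ((stepAux q (get v₂) fun k => S₂ (ι k)).l.elim quit g), v, S⟩ ∧
      get v = (stepAux q (get v₂) fun k => S₂ (ι k)).var ∧
      (∀ k, S (ι k) = (stepAux q (get v₂) fun k => S₂ (ι k)).stk k) ∧
      ∀ k, k ∉ Set.range ι → S k = S₂ k := by
  -- Injectivity of `ι` is needed here: an update of stack `ι k` must not show up on another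
  -- simulated stack.
  have upd : ∀ (S : ∀ k, List (Γ k)) (k : K₁) (a : List (Γ (ι k))),
      (fun j => Function.update S (ι k) a (ι j)) = Function.update (fun j => S (ι j)) k a := by
    intro S k a
    funext j
    by_cases h : j = k
    · subst h; simp
    · rw [Function.update_of_ne h, Function.update_of_ne (hι.ne h)]
  have off : ∀ (S : ∀ k, List (Γ k)) (k : K₁) (a : List (Γ (ι k))) (j : K₂),
      j ∉ Set.range ι → Function.update S (ι k) a j = S j := by
    intro S k a j hj
    exact Function.update_of_ne (fun h => hj ⟨k, h.symm⟩) _ _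
  induction q generalizing v₂ S₂ with
  | push k f q ih =>
    obtain ⟨v, S, h₁, h₂, h₃, h₄⟩ := ih v₂ (Function.update S₂ (ι k) (f (get v₂) :: S₂ (ι k)))
    rw [upd] at h₁ h₂ h₃
    exact ⟨v, S, h₁, h₂, h₃, fun j hj => (h₄ j hj).trans (off _ _ _ _ hj)⟩
  | peek k f q ih =>
    obtain ⟨v, S, h₁, h₂, h₃, h₄⟩ := ih (set v₂ (f (get v₂) (S₂ (ι k)).head?)) S₂
    rw [hgs] at h₁ h₂ h₃
    exact ⟨v, S, h₁, h₂, h₃, h₄⟩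
  | pop k f q ih =>
    obtain ⟨v, S, h₁, h₂, h₃, h₄⟩ := ih (set v₂ (f (get v₂) (S₂ (ι k)).head?))
      (Function.update S₂ (ι k) (S₂ (ι k)).tail)
    rw [upd, hgs] at h₁ h₂ h₃
    exact ⟨v, S, h₁, h₂, h₃, fun j hj => (h₄ j hj).trans (off _ _ _ _ hj)⟩
  | load f q ih =>
    obtain ⟨v, S, h₁, h₂, h₃, h₄⟩ := ih (set v₂ (f (get v₂))) S₂
    rw [hgs] at h₁ h₂ h₃
    exact ⟨v, S, h₁, h₂, h₃, h₄⟩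
  | branch f q q' ih ih' =>
    simp only [embedStmt, stepAux]
    cases f (get v₂)
    · exact ih' v₂ S₂
    · exact ih v₂ S₂
  | goto f => exact ⟨v₂, S₂, rfl, rfl, fun _ => rfl, fun _ _ => rfl⟩
  | halt => exact ⟨v₂, S₂, rfl, rfl, fun _ => rfl, fun _ _ => rfl⟩

end Embedding

/-! ### Terminating runs and the growth of stacks -/

section Halts

variable {K : Type} [DecidableEq K] {Γ : K → Type} {σ Λ : Type}

/-- The program with the given code, started at a label (`none` is the exit), arrives at the exit
after the given number of steps, with the given change of internal state and stacks. -/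
inductive Halts (code : Λ → Stmt Γ (Option Λ) σ) :
    ℕ → Option Λ → σ → (∀ k, List (Γ k)) → σ → (∀ k, List (Γ k)) → Prop
  | exit (v S) : Halts code 0 none v S v S
  | step {n l l' v S v₁ S₁ v₂ S₂} : stepAux (code l) v S = ⟨some l', v₁, S₁⟩ →
      Halts code n l' v₁ S₁ v₂ S₂ → Halts code (n + 1) (some l) v S v₂ S₂

/-- The conclusion is phrased with an arbitrary continuation from `G none`, because the exit of the
inner program may be the exit of the outer one, the start of the next fragment, or the head of a
loop. The target `quit` is irrelevant here: `Halts` has no constructor for a step that executes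
`halt`. -/
theorem Halts.embed {K₁ σ₁ Λ₁ : Type} [DecidableEq K₁] {ι : K₁ → K} (hι : Function.Injective ι)
    {get : σ → σ₁} {set : σ → σ₁ → σ} (hgs : ∀ v a, get (set v a) = a)
    {code₁ : Λ₁ → Stmt (fun k => Γ (ι k)) (Option Λ₁) σ₁} {code : Λ → Stmt Γ (Option Λ) σ}
    {G : Option Λ₁ → Option Λ} {g : Λ₁ → Λ} {quit : Option Λ} (hG : ∀ l, G (some l) = some (g l))
    (hcode : ∀ l, code (g l) = embedStmt ι get set G quit (code₁ l))
    {n : ℕ} {l : Option Λ₁} {v₁ v₁' : σ₁} {S₁ S₁' : ∀ k, List (Γ (ι k))}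
    (h : Halts code₁ n l v₁ S₁ v₁' S₁') {v : σ} {S : ∀ k, List (Γ k)} (hv : get v = v₁)
    (hS : ∀ k, S (ι k) = S₁ k) :
    ∃ v' S', get v' = v₁' ∧ (∀ k, S' (ι k) = S₁' k) ∧ (∀ k, k ∉ Set.range ι → S' k = S k) ∧
      ∀ {m v'' S''}, Halts code m (G none) v' S' v'' S'' →
        Halts code (n + m) (G l) v S v'' S'' := by
  induction h generalizing v S with
  | exit v₁ S₁ =>
    exact ⟨v, S, hv, hS, fun _ _ => rfl, fun h => by rwa [Nat.zero_add]⟩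
  | @step n l l' u T u₁ T₁ u₂ T₂ h _ ih =>
    obtain rfl : (fun k => S (ι k)) = T := funext hS
    subst hv
    obtain ⟨w, R, h₁, h₂, h₃, h₄⟩ := embedStmt_stepAux hι hgs G quit (code₁ l) v S
    rw [h] at h₁ h₂ h₃
    obtain ⟨v', S', i₁, i₂, i₃, i₄⟩ := ih (v := w) (S := R) h₂ h₃
    refine ⟨v', S', i₁, i₂, fun k hk => (i₃ k hk).trans (h₄ k hk), fun hm => ?_⟩
    rw [hG, Nat.add_right_comm]
    exact .step (by rw [hcode, h₁]; rfl) (i₄ hm)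

/-- The number of `push` operations in a statement. -/
def pushCount : Stmt Γ Λ σ → ℕ
  | .push _ _ q => pushCount q + 1
  | .peek _ _ q => pushCount q
  | .pop _ _ q => pushCount q
  | .load _ q => pushCount q
  | .branch _ q q' => pushCount q + pushCount q'
  | .goto _ => 0
  | .halt => 0

theorem length_stepAux_le (q : Stmt Γ Λ σ) (v : σ) (S : ∀ k, List (Γ k)) (k : K) :
    ((stepAux q v S).stk k).length ≤ (S k).length + pushCount q := by
  induction q generalizing v S with
  | push j f q ih =>
    refine (ih _ _).trans ?_
    by_cases h : k = j
    · subst h; simp [pushCount, Nat.add_assoc, Nat.add_comm 1]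
    · rw [Function.update_of_ne h]; simp [pushCount]
  | peek j f q ih => exact ih _ _
  | pop j f q ih =>
    refine (ih _ _).trans ?_
    by_cases h : k = j
    · subst h; simp [pushCount]
    · rw [Function.update_of_ne h]; simp [pushCount]
  | load f q ih => exact ih _ _
  | branch f q q' ih ih' =>
    simp only [stepAux, pushCount]
    cases f v
    · exact (ih' v S).trans (by lia)
    · exact (ih v S).trans (by lia)
  | goto f => simp [pushCount]
  | halt => simp [pushCount]

/-- A step adds at most as many symbols to a stack as its statement contains pushes. There are
finitely many labels, so one constant bounds this for all steps; it makes the output length of a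
polynomial-time machine polynomial. -/
theorem Halts.length_le [Fintype Λ] {code : Λ → Stmt Γ (Option Λ) σ} {n l v S v' S'}
    (h : Halts code n l v S v' S') (k : K) :
    (S' k).length ≤ (S k).length + n * ∑ l, pushCount (code l) := by
  induction h with
  | exit => simp
  | @step n l l' v S v₁ S₁ v₂ S₂ h _ ih =>
    have h₁ := length_stepAux_le (code l) v S k
    rw [h] at h₁
    have h₂ : pushCount (code l) ≤ ∑ l, pushCount (code l) :=
      Finset.single_le_sum (f := fun l => pushCount (code l)) (fun _ _ => Nat.zero_le _) (Finset.mem_univ l)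
    simp only at h₁
    linarith [Nat.add_mul n 1 (∑ l, pushCount (code l))]

end Halts

/-- A program fragment: finitely many labels, and a statement for each of them. Jumping to `none`
means leaving the fragment. -/
structure Frag {K : Type} (Γ : K → Type) (σ : Type) where
  Λ : Type
  fin : Fintype Λ
  main : Λ
  code : Λ → Stmt Γ (Option Λ) σ

attribute [instance] Frag.fin

/-! ### Combinators for program fragments -/

namespace Frag

section

variable {K : Type} [DecidableEq K] {Γ : K → Type} {σ : Type}

/-- The fragment takes at most `t` steps to transform the stacks `S` into `S'`, whatever the
internal state is. -/
def Runs (p : Frag Γ σ) (S : ∀ k, List (Γ k)) (t : ℕ) (S' : ∀ k, List (Γ k)) : Prop :=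
  ∀ v, ∃ n ≤ t, ∃ v', Halts p.code n (some p.main) v S v' S'

theorem Runs.mono {p : Frag Γ σ} {S S' : ∀ k, List (Γ k)} {t t' : ℕ} (h : p.Runs S t S')
    (ht : t ≤ t') : p.Runs S t' S' := fun v =>
  let ⟨n, hn, h⟩ := h v
  ⟨n, hn.trans ht, h⟩

/-- One fragment after another. -/
def seq (p q : Frag Γ σ) : Frag Γ σ where
  Λ := p.Λ ⊕ q.Λ
  fin := inferInstance
  main := .inl p.main
  code
    | .inl l => embedStmt (Γ := Γ) id id (fun _ v => v)
        (fun o : Option p.Λ => o.elim (some (.inr q.main)) fun l => some (.inl l)) none (p.code l)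
    | .inr l => embedStmt (Γ := Γ) id id (fun _ v => v)
        (fun o : Option q.Λ => o.elim none fun l => some (.inr l)) none (q.code l)

theorem Runs.seq {p q : Frag Γ σ} {S S' S'' : ∀ k, List (Γ k)} {t t' : ℕ} (hp : p.Runs S t S')
    (hq : q.Runs S' t' S'') : (p.seq q).Runs S (t + t') S'' := by
  intro v
  obtain ⟨n, hn, v', h⟩ := hp v
  obtain ⟨n', hn', v'', h'⟩ := hq v'
  obtain ⟨w, R, h₁, h₂, -, h₄⟩ := Halts.embed (Γ := Γ) (code := (p.seq q).code) (ι := id)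
    (get := id) Function.injective_id (set := fun _ v => v) (fun _ _ => rfl)
    (G := fun o => o.elim (some (.inr q.main)) fun l => some (.inl l)) (g := Sum.inl) (quit := none)
    (fun l => rfl) (fun l => rfl) h rfl (fun _ => rfl)
  obtain ⟨w', R', h₁', h₂', -, h₄'⟩ := Halts.embed (Γ := Γ) (code := (p.seq q).code) (ι := id)
    (get := id) Function.injective_id (set := fun _ v => v) (fun _ _ => rfl)
    (G := fun o => o.elim none fun l => some (.inr l)) (g := Sum.inr) (quit := none) (fun l => rfl) (fun l => rfl) h' (v := w) (S := R) h₁ h₂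
  obtain rfl : R' = S'' := funext h₂'
  exact ⟨n + (n' + 0), by lia, w', h₄ (h₄' (.exit _ _))⟩

/-- Push symbols onto stacks, the last symbol of the list first. -/
def pushes (L : List (Σ k, Γ k)) : Frag Γ σ where
  Λ := Unit
  fin := inferInstance
  main := ()
  code _ := L.foldl (fun q a => .push a.1 (fun _ => a.2) q) (.goto fun _ => none)

/-- The stacks after pushing the symbols in the list, the last one first. -/
def pushAll (L : List (Σ k, Γ k)) (S : ∀ k, List (Γ k)) : ∀ k, List (Γ k) :=
  L.foldr (fun a S => Function.update S a.1 (a.2 :: S a.1)) S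

theorem runs_pushes (L : List (Σ k, Γ k)) (S : ∀ k, List (Γ k)) :
    (pushes (σ := σ) L).Runs S 1 (pushAll L S) := by
  intro v
  refine ⟨1, le_rfl, v, .step ?_ (.exit _ _)⟩
  -- The left fold puts later list entries outermost, so they are pushed first; its accumulator `q`
  -- has to be generalized for the induction.
  have : ∀ (L : List (Σ k, Γ k)) (q : Stmt Γ (Option Unit) σ) S,
      stepAux (L.foldl (fun q a => .push a.1 (fun _ => a.2) q) q) v S =
        stepAux q v (pushAll L S) := by
    intro L
    induction L with
    | nil => intro q S; rfl
    | cons a L ih => intro q S; rw [List.foldl_cons, ih]; rfl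
  exact this L _ S

/-- Carry out `p`, with its internal state initialized by `init`, on the stacks `ι k` and on a part
of the internal state. -/
def within {K₁ σ₁ : Type} (ι : K₁ → K) (set : σ → σ₁ → σ) (get : σ → σ₁) (init : σ₁)
    (p : Frag (fun k => Γ (ι k)) σ₁) : Frag Γ σ where
  Λ := Option p.Λ
  fin := inferInstance
  main := none
  code
    | none => .load (fun v => set v init) (.goto fun _ => some (some p.main))
    | some l => embedStmt ι get set (Option.map some) none (p.code l)

/-- The run of `p` is only required from the state `init`, which the extra first step installs. This
is what allows a Turing machine, specified only from its initial state, to be used as a fragment. -/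
theorem runs_within {K₁ σ₁ : Type} [DecidableEq K₁] {ι : K₁ → K} (hι : Function.Injective ι)
    {get : σ → σ₁} {set : σ → σ₁ → σ} (hgs : ∀ v a, get (set v a) = a) {init : σ₁}
    {p : Frag (fun k => Γ (ι k)) σ₁} {S S' : ∀ k, List (Γ k)} {t : ℕ}
    (h : ∃ n ≤ t, ∃ v', Halts p.code n (some p.main) init (fun k => S (ι k)) v'
      fun k => S' (ι k)) (hS : ∀ k, k ∉ Set.range ι → S' k = S k) :
    (p.within ι set get init).Runs S (t + 1) S' := by
  intro v
  obtain ⟨n, hn, v', h⟩ := h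
  obtain ⟨w, R, -, h₂, h₃, h₄⟩ := Halts.embed (code := (p.within ι set get init).code) hι hgs
    (G := Option.map some) (g := some) (quit := none) (fun l => rfl) (fun l => rfl) h (v := set v init) (S := S) (hgs _ _)
    (fun _ => rfl)
  obtain rfl : R = S' := by
    funext k
    by_cases hk : k ∈ Set.range ι
    · obtain ⟨k, rfl⟩ := hk; exact h₂ k
    · rw [h₃ k hk, hS k hk]
  exact ⟨n + 0 + 1, by lia, w, .step (l' := some (some p.main)) (v₁ := set v init) (S₁ := S) rfl
    (h₄ (.exit _ _))⟩

end

/-! ### Loops that consume a stack -/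

section Loop

variable {K : Type} [DecidableEq K] {Γ : K → Type} {τ : Type}

/-- Pop symbols `a` from stack `k` and carry out `body (dec a)` for each of them, until a symbol
with `quit (dec a)` has been popped or the stack is empty. -/
noncomputable def loop (k : K) (dec : Γ k → Sym) (quit : Sym → Bool) (body : Sym → Frag Γ (τ × Option Sym)) :
    Frag Γ (τ × Option Sym) where
  Λ := Option (Σ s, (body s).Λ)
  fin := inferInstance
  main := none
  code
    | none => .pop k (fun v a => (v.1, a.map dec)) (.goto fun v =>
        v.2.elim none fun s => if quit s then none else some (some ⟨s, (body s).main⟩))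
    | some ⟨s, l⟩ => embedStmt (Γ := Γ) id id (fun _ v => v)
        (fun o : Option (body s).Λ => some (o.map fun l => ⟨s, l⟩)) none ((body s).code l)

variable {k : K} {dec : Γ k → Sym} {quit : Sym → Bool} {body : Sym → Frag Γ (τ × Option Sym)}
  {S S' S'' : ∀ k, List (Γ k)} {a : Γ k} {as : List (Γ k)} {t t' : ℕ}

theorem runs_loop_nil (hS : S k = []) : (loop k dec quit body).Runs S 1 S := by
  intro v
  refine ⟨1, le_rfl, (v.1, none), .step (l' := none) ?_ (.exit _ _)⟩
  have : Function.update S k [] = S := by rw [← hS, Function.update_eq_self]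
  simp [loop, hS, this]

theorem runs_loop_quit (hS : S k = a :: as) (ha : quit (dec a) = true) :
    (loop k dec quit body).Runs S 1 (Function.update S k as) := by
  intro v
  refine ⟨1, le_rfl, (v.1, some (dec a)), .step (l' := none) ?_ (.exit _ _)⟩
  simp [loop, hS, ha]

/-- One step for the pop, then the body for the symbol read, whose exit leads back to the head of
the loop. -/
theorem runs_loop_cons (hS : S k = a :: as) (ha : quit (dec a) = false)
    (hb : (body (dec a)).Runs (Function.update S k as) t S')
    (hl : (loop k dec quit body).Runs S' t' S'') :
    (loop k dec quit body).Runs S (1 + t + t') S'' := by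
  intro v
  obtain ⟨n, hn, v', h⟩ := hb (v.1, some (dec a))
  obtain ⟨n', hn', v'', h'⟩ := hl v'
  obtain ⟨w, R, h₁, h₂, -, h₄⟩ := Halts.embed (Γ := Γ) (code := (loop k dec quit body).code)
    (ι := id) (get := id) Function.injective_id (set := fun _ v => v) (fun _ _ => rfl)
    (G := fun o => some (o.map fun l => ⟨dec a, l⟩)) (g := fun l => some ⟨dec a, l⟩)
    (quit := none) (fun l => rfl) (fun l => rfl) h rfl (fun _ => rfl)
  obtain rfl : R = S' := funext h₂
  obtain rfl : w = v' := h₁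
  have h₅ := h₄ h'
  rw [Option.map_some] at h₅
  refine ⟨n + n' + 1, by lia, v'', .step ?_ h₅⟩
  simp [loop, hS, ha]

end Loop

end Frag

end QEnc

namespace QEnc

open Turing TM2

/-! ### Loops whose bodies only push -/

namespace Frag

section

variable {K : Type} [DecidableEq K] {Γ : K → Type} {τ σ : Type}

/-- The symbols in the list that are pushed onto stack `j`. -/
def onStack (j : K) (L : List (Σ k, Γ k)) : List (Γ j) :=
  L.filterMap fun a => if h : a.1 = j then some (h ▸ a.2) else none

theorem pushAll_apply (L : List (Σ k, Γ k)) (S : ∀ k, List (Γ k)) (j : K) :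
    pushAll L S j = onStack j L ++ S j := by
  induction L with
  | nil => rfl
  | cons a L ih =>
    obtain ⟨k, a⟩ := a
    change Function.update (pushAll L S) k (a :: pushAll L S k) j = _
    by_cases h : k = j
    · subst h
      rw [Function.update_self, ih]
      simp [onStack]
    · rw [Function.update_of_ne (Ne.symm h), ih]
      simp [onStack, h]

/-- Final stacks are described pointwise, so that for concrete stacks the proof is a case
distinction. -/
theorem runs_pushes' {L : List (Σ k, Γ k)} {S S' : ∀ k, List (Γ k)}
    (h : ∀ j, S' j = onStack j L ++ S j) : (pushes (σ := σ) L).Runs S 1 S' := by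
  obtain rfl : S' = pushAll L S := funext fun j => (h j).trans (pushAll_apply L S j).symm
  exact runs_pushes L S

/-- A loop whose body pushes, for each symbol that is read, certain symbols onto other stacks. -/
theorem runs_loop_pushes {k : K} {dec : Γ k → Sym} {quit : Sym → Bool}
    {L : Sym → List (Σ k, Γ k)} (hL : ∀ s, onStack k (L s) = []) {S S' : ∀ k, List (Γ k)}
    {as r rest : List (Γ k)} (hS : S k = as ++ r) (has : ∀ a ∈ as, quit (dec a) = false)
    (hr : r = [] ∧ rest = [] ∨ ∃ a, r = a :: rest ∧ quit (dec a) = true) (hk : S' k = rest)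
    (hS' : ∀ j ≠ k, S' j = (as.reverse.flatMap fun a => onStack j (L (dec a))) ++ S j) {t : ℕ}
    (ht : t = 2 * as.length + 1) :
    (loop (τ := τ) k dec quit fun s => pushes (L s)).Runs S t S' := by
  subst ht
  induction as generalizing S with
  | nil =>
    rcases hr with ⟨rfl, rfl⟩ | ⟨a, rfl, ha⟩
    · obtain rfl : S' = S := by
        funext j
        by_cases h : j = k
        · subst h; rw [hk, hS]; rfl
        · rw [hS' j h]; rfl
      exact runs_loop_nil hS
    · obtain rfl : S' = Function.update S k rest := by
        funext j
        by_cases h : j = k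
        · subst h; rw [hk, Function.update_self]
        · rw [hS' j h, Function.update_of_ne h]; rfl
      exact runs_loop_quit hS ha
  | cons a as ih =>
    have := runs_loop_cons (τ := τ) (body := fun s => pushes (L s)) (dec := dec) hS
      (has a List.mem_cons_self) (runs_pushes _ _)
      (ih (S := pushAll (L (dec a)) (Function.update S k (as ++ r)))
        (by rw [pushAll_apply, hL, Function.update_self]; rfl)
        (fun b hb => has b (List.mem_cons_of_mem _ hb)) fun j hj => by
          rw [hS' j hj, pushAll_apply, Function.update_of_ne hj]
          simp [List.flatMap_append])
    exact this.mono (by simp; lia)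

end

section

variable {K : Type} [DecidableEq K] {Γ : K → Type} {τ : Type}

/-- Moving the contents of one stack to another one. -/
theorem runs_move {k j : K} (hkj : k ≠ j) {dec : Γ k → Sym} {f : Sym → Γ j}
    {S S' : ∀ k, List (Γ k)} {as : List (Γ k)} (h : S k = as) (hk : S' k = [])
    (hj : S' j = (as.map fun a => f (dec a)).reverse ++ S j)
    (hS' : ∀ i, i ≠ k → i ≠ j → S' i = S i) :
    (loop (τ := τ) k dec (fun _ => false) fun s => pushes [⟨j, f s⟩]).Runs S
      (2 * as.length + 1) S' := by
  refine runs_loop_pushes (r := []) (rest := []) (as := as) ?_ (by simpa using h) (fun _ _ => rfl)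
    (.inl ⟨rfl, rfl⟩) hk (fun i hi => ?_) rfl
  · simp [onStack, hkj.symm]
  · by_cases hij : i = j
    · subst hij
      have : ∀ l : List (Γ k), (l.flatMap fun a => [f (dec a)]) = l.map fun a => f (dec a) := by
        intro l
        induction l with
        | nil => rfl
        | cons a l ih => rw [List.flatMap_cons, ih]; rfl
      simp [onStack, hj, this]
    · simp [onStack, Ne.symm hij, hS' i hi hij, List.flatMap]

/-- Moving the contents of one stack to two other ones. -/
theorem runs_fork {k j j' : K} (hkj : k ≠ j) (hkj' : k ≠ j') (hjj' : j ≠ j') {dec : Γ k → Sym}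
    {x : Γ j} {y : Γ j'} {S S' : ∀ k, List (Γ k)} {as : List (Γ k)} (h : S k = as) (hk : S' k = [])
    (hj : S' j = List.replicate as.length x ++ S j)
    (hj' : S' j' = List.replicate as.length y ++ S j')
    (hS' : ∀ i, i ≠ k → i ≠ j → i ≠ j' → S' i = S i) :
    (loop (τ := τ) k dec (fun _ => false) fun _ => pushes [⟨j, x⟩, ⟨j', y⟩]).Runs S
      (2 * as.length + 1) S' := by
  have rep : ∀ {α : Type} (x : α), List.replicate as.length x =
      as.reverse.flatMap fun _ => [x] := by
    intro α x
    rw [← List.length_reverse]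
    induction as.reverse with
    | nil => rfl
    | cons a l ih => rw [List.length_cons, List.replicate_succ, List.flatMap_cons, ih]; rfl
  refine runs_loop_pushes (r := []) (rest := []) (as := as) ?_ (by simpa using h) (fun _ _ => rfl)
    (.inl ⟨rfl, rfl⟩) hk (fun i hi => ?_) rfl
  · simp [onStack, hkj.symm, hkj'.symm]
  · by_cases hij : i = j
    · subst hij
      simp [onStack, hj, hjj'.symm, rep]
    · by_cases hij' : i = j'
      · subst hij'
        simp [onStack, hj', hjj', rep]
      · simp [onStack, Ne.symm hij, Ne.symm hij', hS' i hi hij hij', List.flatMap]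

end

/-! ### Passing between Turing machines and fragments -/

/-- A Turing machine as a fragment. -/
def ofTM (tm : FinTM2) : Frag tm.Γ tm.σ where
  Λ := tm.Λ
  fin := tm.ΛFin
  main := tm.main
  code l := embedStmt (Γ := tm.Γ) id id (fun _ v => v) some none (tm.m l)

theorem halts_ofTM (tm : FinTM2) (n : ℕ) (l : Option tm.Λ) (v : tm.σ)
    (S : ∀ k, List (tm.Γ k)) (v' : tm.σ) (S' : ∀ k, List (tm.Γ k))
    (h : (flip bind (TM2.step tm.m))^[n] (some ⟨l, v, S⟩) = some ⟨none, v', S'⟩) :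
    Halts (ofTM tm).code n l v S v' S' := by
  induction n generalizing l v S with
  | zero =>
    simp only [Function.iterate_zero, id_eq, Option.some.injEq, Cfg.mk.injEq] at h
    obtain ⟨rfl, rfl, rfl⟩ := h
    exact .exit _ _
  | succ n ih =>
    rw [Function.iterate_succ_apply] at h
    cases l with
    | none =>
      -- A halted configuration has no successor and `none` is a fixed point of the iteration, so no
      -- steps can remain after halting.
      have h₀ : (flip bind (TM2.step tm.m)) (some (⟨none, v, S⟩ : Cfg tm.Γ tm.Λ tm.σ)) = none := rfl
      rw [h₀, Function.iterate_fixed rfl] at h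
      cases h
    | some l =>
      obtain ⟨w, R, h₁, h₂, h₃, -⟩ := embedStmt_stepAux (Γ := tm.Γ) Function.injective_id
        (get := id) (set := fun _ v => v) (fun _ _ => rfl) some none (tm.m l) v S
      refine .step h₁ ?_
      obtain rfl : R = _ := funext h₃
      obtain rfl : w = _ := h₂
      refine ih _ _ _ (Eq.trans ?_ h)
      congr 1
      change _ = some (stepAux (tm.m l) v S)
      congr 1
      change Cfg.mk ((stepAux (tm.m l) v S).l.elim none some) (stepAux (tm.m l) v S).var
        (stepAux (tm.m l) v S).stk = stepAux (tm.m l) v S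
      rcases stepAux (tm.m l) v S with ⟨l' | l', u, T⟩ <;> rfl

section

variable {K : Type} [DecidableEq K] [Fintype K] {Γ : K → Type} {σ : Type} [Fintype σ]

/-- The machine that carries out a fragment, cleans up the internal state, and halts. -/
def toTM (p : Frag Γ σ) (k₀ k₁ : K) (init : σ) (hk₀ : Fintype (Γ k₀)) : FinTM2 where
  K := K
  k₀ := k₀
  k₁ := k₁
  Γ := Γ
  Λ := Option p.Λ
  main := some p.main
  σ := σ
  initialState := init
  m
    | none => .load (fun _ => init) .halt
    | some l => p.code l

/-- The additional step is the one at label `none`, which restores the initial internal state;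
`haltList` requires this. -/
theorem iterate_toTM (p : Frag Γ σ) (k₀ k₁ : K) (init : σ) (hk₀ : Fintype (Γ k₀)) {n l v S v' S'}
    (h : Halts p.code n l v S v' S') :
    (flip bind (TM2.step (p.toTM k₀ k₁ init hk₀).m))^[n + 1] (some ⟨some l, v, S⟩) =
      some ⟨none, init, S'⟩ := by
  induction h with
  | exit v S => rfl
  | @step n l l' v S v₁ S₁ v₂ S₂ h _ ih =>
    rw [Function.iterate_succ_apply]
    refine Eq.trans ?_ ih
    congr 1
    change some (stepAux (p.code l) v S) = _
    rw [h]
    rfl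

end

end Frag

theorem initList_eq (tm : FinTM2) (s : List (tm.Γ tm.k₀)) :
    initList tm s = ⟨some tm.main, tm.initialState, Function.update (fun _ => []) tm.k₀ s⟩ := by
  unfold initList
  congr 1
  funext k
  by_cases h : k = tm.k₀
  · subst h; simp
  · simp [h]

theorem haltList_eq (tm : FinTM2) (s : List (tm.Γ tm.k₁)) :
    haltList tm s = ⟨none, tm.initialState, Function.update (fun _ => []) tm.k₁ s⟩ := by
  unfold haltList
  congr 1
  funext k
  by_cases h : k = tm.k₁
  · subst h; simp
  · simp [h]

theorem unaryEncodeNat_eq (n : ℕ) :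
    Computability.unaryEncodeNat n = List.replicate n true := by
  induction n with
  | zero => rfl
  | succ n ih => rw [Computability.unaryEncodeNat, ih, List.replicate_succ]

theorem eval_mono (p : Polynomial ℕ) : Monotone fun n => p.eval n := by
  intro a b h
  simp only [Polynomial.eval_eq_sum_range]
  exact Finset.sum_le_sum fun i _ => Nat.mul_le_mul_left _ (Nat.pow_le_pow_left h i)

/-- Functions from unary numbers to descriptions that are computable in polynomial time. -/
abbrev PolyTime (F : ℕ → List Sym) : Prop :=
  Nonempty (TM2ComputableInPolyTime Computability.unaryEncodeNat (id : List Sym → List Sym) F)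

/-! ### Running two machines on the same input and processing their outputs -/

section Combine

variable {Own : Type}

/-- The stack alphabets of a machine with stacks of its own and the stacks of two machines. -/
abbrev CombΓ (Own : Type) (tm₁ tm₂ : FinTM2) : Own ⊕ tm₁.K ⊕ tm₂.K → Type :=
  Sum.elim (fun _ => Sym) (Sum.elim tm₁.Γ tm₂.Γ)

/-- The internal state of such a machine. -/
abbrev Combσ (tm₁ tm₂ : FinTM2) : Type := (tm₁.σ × tm₂.σ) × Option Sym

/-- The stacks of such a machine. -/
def combStk {tm₁ tm₂ : FinTM2} (o : Own → List Sym) (s₁ : ∀ k, List (tm₁.Γ k))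
    (s₂ : ∀ k, List (tm₂.Γ k)) : ∀ k, List (CombΓ Own tm₁ tm₂ k)
  | .inl k => o k
  | .inr (.inl k) => s₁ k
  | .inr (.inr k) => s₂ k

section

variable {tm₁ tm₂ : FinTM2} {o : Own → List Sym} {s₁ : ∀ k, List (tm₁.Γ k)}
  {s₂ : ∀ k, List (tm₂.Γ k)}

theorem combStk_own_self [DecidableEq Own] {k : Own} {l : List Sym} :
    combStk (Function.update o k l) s₁ s₂ (.inl k) = l :=
  Function.update_self (β := fun _ => List Sym) k l o

theorem combStk_own_of_ne [DecidableEq Own] {j k : Own} {l : List Sym} (h : j ≠ k) :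
    combStk (Function.update o k l) s₁ s₂ (.inl j) = o j :=
  Function.update_of_ne (β := fun _ => List Sym) h l o

theorem combStk_fst_self {k : tm₁.K} {l : List (tm₁.Γ k)} :
    combStk o (Function.update s₁ k l) s₂ (.inr (.inl k)) = l :=
  Function.update_self (β := fun k => List (tm₁.Γ k)) k l s₁

theorem combStk_fst_of_ne {j k : tm₁.K} {l : List (tm₁.Γ k)} (h : j ≠ k) :
    combStk o (Function.update s₁ k l) s₂ (.inr (.inl j)) = s₁ j :=
  Function.update_of_ne (β := fun k => List (tm₁.Γ k)) h l s₁

theorem combStk_snd_self {k : tm₂.K} {l : List (tm₂.Γ k)} :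
    combStk o s₁ (Function.update s₂ k l) (.inr (.inr k)) = l :=
  Function.update_self (β := fun k => List (tm₂.Γ k)) k l s₂

theorem combStk_snd_of_ne {j k : tm₂.K} {l : List (tm₂.Γ k)} (h : j ≠ k) :
    combStk o s₁ (Function.update s₂ k l) (.inr (.inr j)) = s₂ j :=
  Function.update_of_ne (β := fun k => List (tm₂.Γ k)) h l s₂

end

open Frag

variable [DecidableEq Own]

/-- Run both machines on the input of the first one, move their outputs (in reverse order) to the
stacks `a` and `b`, and then run the program `P`. -/
noncomputable def combine (h₁ h₂ : TM2ComputableAux Bool Sym) (a b : Own)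
    (P : Frag (fun _ : Own => Sym) (Unit × Option Sym)) :
    Frag (CombΓ Own h₁.tm h₂.tm) (Combσ h₁.tm h₂.tm) :=
  seq (loop (.inr (.inl h₁.tm.k₀)) (fun _ => .tick) (fun _ => false)
    fun s => pushes [⟨.inl a, s⟩]) <|
  seq (loop (.inl a) id (fun _ => false) fun _ =>
    pushes [⟨.inr (.inl h₁.tm.k₀), h₁.inputAlphabet.symm true⟩,
      ⟨.inr (.inr h₂.tm.k₀), h₂.inputAlphabet.symm true⟩]) <|
  seq (within (fun k => .inr (.inl k)) (fun v x => ((x, v.1.2), v.2)) (fun v => v.1.1)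
    h₁.tm.initialState (ofTM h₁.tm)) <|
  seq (within (fun k => .inr (.inr k)) (fun v x => ((v.1.1, x), v.2)) (fun v => v.1.2)
    h₂.tm.initialState (ofTM h₂.tm)) <|
  seq (loop (.inr (.inl h₁.tm.k₁)) h₁.outputAlphabet (fun _ => false)
    fun s => pushes [⟨.inl a, s⟩]) <|
  seq (loop (.inr (.inr h₂.tm.k₁)) h₂.outputAlphabet (fun _ => false)
    fun s => pushes [⟨.inl b, s⟩]) <|
  within Sum.inl (fun v x => (v.1, x.2)) (fun v => ((), v.2)) ((), none) P

theorem combStk_update_left {tm₁ tm₂ : FinTM2} (k : Own) (l : List Sym) :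
    combStk (tm₁ := tm₁) (tm₂ := tm₂) (Function.update (fun _ => []) k l) (fun _ => [])
      (fun _ => []) =
        Function.update (β := fun k => List (CombΓ Own tm₁ tm₂ k)) (fun _ => []) (.inl k) l := by
  funext j
  rcases j with j | j | j
  · by_cases h : j = k
    · subst h
      exact combStk_own_self.trans
        (Function.update_self (β := fun k => List (CombΓ Own tm₁ tm₂ k)) (.inl j) l _).symm
    · exact (combStk_own_of_ne h).trans
        (Function.update_of_ne (β := fun k => List (CombΓ Own tm₁ tm₂ k))
          (a := .inl j) (a' := .inl k) (fun h' => h (Sum.inl.inj h')) l fun _ => []).symm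
  · rfl
  · rfl

theorem combStk_update_right {tm₁ tm₂ : FinTM2} (k : tm₁.K) (l : List (tm₁.Γ k)) :
    combStk (Own := Own) (tm₂ := tm₂) (fun _ => []) (Function.update (fun _ => []) k l)
      (fun _ => []) =
        Function.update (β := fun k => List (CombΓ Own tm₁ tm₂ k)) (fun _ => []) (.inr (.inl k)) l := by
  funext j
  rcases j with j | j | j
  · rfl
  · by_cases h : j = k
    · subst h
      exact combStk_fst_self.trans
        (Function.update_self (β := fun k => List (CombΓ Own tm₁ tm₂ k)) (.inr (.inl j)) l _).symm
    · exact (combStk_fst_of_ne h).trans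
        (Function.update_of_ne (β := fun k => List (CombΓ Own tm₁ tm₂ k))
          (a := .inr (.inl j)) (a' := .inr (.inl k))
          (fun h' => h (Sum.inl.inj (Sum.inr.inj h'))) l fun _ => []).symm
  · rfl

/-- The unary input is parked on `a` as ticks, copied to both input stacks, and after the two runs
the outputs are moved to `a` and `b`, which reverses them. A halted machine leaves only its output
stack nonempty, so all stacks but those of `P` are empty at the end. -/
theorem runs_combine {h₁ h₂ : TM2ComputableAux Bool Sym} {a b : Own} (hab : a ≠ b)
    {P : Frag (fun _ : Own => Sym) (Unit × Option Sym)} {n t₁ t₂ t : ℕ} {d₁ d₂ : List Sym}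
    (H₁ : Nonempty (TM2OutputsInTime h₁.tm (List.map h₁.inputAlphabet.invFun
      (Computability.unaryEncodeNat n)) (some (d₁.map h₁.outputAlphabet.invFun)) t₁))
    (H₂ : Nonempty (TM2OutputsInTime h₂.tm (List.map h₂.inputAlphabet.invFun
      (Computability.unaryEncodeNat n)) (some (d₂.map h₂.outputAlphabet.invFun)) t₂))
    {o : Own → List Sym}
    (hP : P.Runs (Function.update (Function.update (fun _ => []) a d₁.reverse) b d₂.reverse) t o) :
    (combine h₁ h₂ a b P).Runs
      (combStk (fun _ => []) (Function.update (fun _ => []) h₁.tm.k₀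
        (List.map h₁.inputAlphabet.invFun (Computability.unaryEncodeNat n))) (fun _ => []))
      (4 * n + t₁ + t₂ + 2 * d₁.length + 2 * d₂.length + t + 7)
      (combStk o (fun _ => []) (fun _ => [])) := by
  obtain ⟨H₁⟩ := H₁
  obtain ⟨H₂⟩ := H₂
  have e₁ := H₁.evals_in_steps
  have e₂ := H₂.evals_in_steps
  simp only [Option.map_some, initList_eq, haltList_eq, unaryEncodeNat_eq, List.map_replicate]
    at e₁ e₂
  simp only [unaryEncodeNat_eq, List.map_replicate]
  replace e₁ := halts_ofTM _ _ _ _ _ _ _ e₁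
  replace e₂ := halts_ofTM _ _ _ _ _ _ _ e₂
  set x₁ := h₁.inputAlphabet.symm true with hx₁
  set x₂ := h₂.inputAlphabet.symm true with hx₂
  change Halts _ _ _ _ (Function.update _ _ (List.replicate n x₁)) _ _ at e₁
  change Halts _ _ _ _ (Function.update _ _ (List.replicate n x₂)) _ _ at e₂
  set y₁ := List.map h₁.outputAlphabet.symm d₁ with hy₁
  set y₂ := List.map h₂.outputAlphabet.symm d₂ with hy₂
  change Halts _ _ _ _ _ _ (Function.update _ _ y₁) at e₁
  change Halts _ _ _ _ _ _ (Function.update _ _ y₂) at e₂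
  refine Runs.mono (Runs.seq (t := 2 * n + 1)
    (S' := combStk (Function.update (fun _ => []) a (List.replicate n .tick)) (fun _ => [])
      (fun _ => [])) ?_ <|
    Runs.seq (t := 2 * n + 1)
      (S' := combStk (fun _ => []) (Function.update (fun _ => []) h₁.tm.k₀ (List.replicate n x₁))
        (Function.update (fun _ => []) h₂.tm.k₀ (List.replicate n x₂))) ?_ <|
    Runs.seq (t := t₁ + 1)
      (S' := combStk (fun _ => []) (Function.update (fun _ => []) h₁.tm.k₁ y₁)
        (Function.update (fun _ => []) h₂.tm.k₀ (List.replicate n x₂))) ?_ <|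
    Runs.seq (t := t₂ + 1)
      (S' := combStk (fun _ => []) (Function.update (fun _ => []) h₁.tm.k₁ y₁)
        (Function.update (fun _ => []) h₂.tm.k₁ y₂)) ?_ <|
    Runs.seq (t := 2 * d₁.length + 1)
      (S' := combStk (Function.update (fun _ => []) a d₁.reverse) (fun _ => [])
        (Function.update (fun _ => []) h₂.tm.k₁ y₂)) ?_ <|
    Runs.seq (t := 2 * d₂.length + 1) (t' := t + 1)
      (S' := combStk (Function.update (Function.update (fun _ => []) a d₁.reverse) b d₂.reverse)
        (fun _ => []) (fun _ => [])) ?_ ?_) (by lia)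
  · have := runs_move (Γ := CombΓ Own h₁.tm h₂.tm) (τ := h₁.tm.σ × h₂.tm.σ)
      (k := .inr (.inl h₁.tm.k₀)) (j := .inl a) (dec := fun _ => .tick) (f := id) (by simp)
      (S := combStk (fun _ => []) (Function.update (fun _ => []) h₁.tm.k₀ (List.replicate n x₁))
        (fun _ => []))
      (S' := combStk (Function.update (fun _ => []) a (List.replicate n .tick)) (fun _ => [])
        (fun _ => []))
      combStk_fst_self rfl
      (combStk_own_self.trans (show List.replicate n Sym.tick =
        (List.map (fun _ => Sym.tick) (List.replicate n x₁)).reverse ++ ([] : List Sym) by simp)) (by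
        rintro (j | j | j) h h'
        · exact combStk_own_of_ne (o := fun _ => []) (fun e => h' (congrArg _ e))
        · exact (combStk_fst_of_ne (s₁ := fun _ => []) (fun e => h (congrArg (fun x => Sum.inr (Sum.inl x)) e))).symm
        · rfl)
    exact this.mono (le_of_eq (congrArg (fun m => 2 * m + 1) List.length_replicate))
  · have := runs_fork (Γ := CombΓ Own h₁.tm h₂.tm) (τ := h₁.tm.σ × h₂.tm.σ)
      (k := .inl a) (j := .inr (.inl h₁.tm.k₀)) (j' := .inr (.inr h₂.tm.k₀)) (dec := id)
      (x := x₁) (y := x₂) (by simp) (by simp) (by simp)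
      (S := combStk (Function.update (fun _ => []) a (List.replicate n .tick)) (fun _ => [])
        (fun _ => []))
      (S' := combStk (fun _ => []) (Function.update (fun _ => []) h₁.tm.k₀ (List.replicate n x₁))
        (Function.update (fun _ => []) h₂.tm.k₀ (List.replicate n x₂)))
      combStk_own_self rfl
      (combStk_fst_self.trans (show List.replicate n x₁ =
        List.replicate (List.replicate n Sym.tick).length x₁ ++ ([] : List (h₁.tm.Γ h₁.tm.k₀)) by simp))
      (combStk_snd_self.trans (show List.replicate n x₂ =
        List.replicate (List.replicate n Sym.tick).length x₂ ++ ([] : List (h₂.tm.Γ h₂.tm.k₀)) by simp)) (by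
        rintro (j | j | j) h h' h''
        · exact (combStk_own_of_ne (o := fun _ => []) (fun e => h (congrArg _ e))).symm
        · exact combStk_fst_of_ne (s₁ := fun _ => []) (fun e => h' (congrArg (fun x => Sum.inr (Sum.inl x)) e))
        · exact combStk_snd_of_ne (s₂ := fun _ => []) (fun e => h'' (congrArg (fun x => Sum.inr (Sum.inr x)) e)))
    exact this.mono (le_of_eq (congrArg (fun m => 2 * m + 1) List.length_replicate))
  · refine runs_within (fun _ _ h => by simpa using h) (fun _ _ => rfl)
      ⟨_, H₁.steps_le_m, _, e₁⟩ ?_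
    rintro (j | j | j) hj
    · rfl
    · exact (hj ⟨j, rfl⟩).elim
    · rfl
  · refine runs_within (fun _ _ h => by simpa using h) (fun _ _ => rfl)
      ⟨_, H₂.steps_le_m, _, e₂⟩ ?_
    rintro (j | j | j) hj
    · rfl
    · rfl
    · exact (hj ⟨j, rfl⟩).elim
  · have := runs_move (Γ := CombΓ Own h₁.tm h₂.tm) (τ := h₁.tm.σ × h₂.tm.σ)
      (k := .inr (.inl h₁.tm.k₁)) (j := .inl a) (dec := h₁.outputAlphabet) (f := id) (by simp)
      (S := combStk (fun _ => []) (Function.update (fun _ => []) h₁.tm.k₁ y₁)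
        (Function.update (fun _ => []) h₂.tm.k₁ y₂))
      (S' := combStk (Function.update (fun _ => []) a d₁.reverse) (fun _ => [])
        (Function.update (fun _ => []) h₂.tm.k₁ y₂))
      combStk_fst_self rfl
      (combStk_own_self.trans (show d₁.reverse =
        (List.map (fun a => h₁.outputAlphabet a) y₁).reverse ++ ([] : List Sym) by
          simp [hy₁, Function.comp_def])) (by
        rintro (j | j | j) h h'
        · exact combStk_own_of_ne (o := fun _ => []) (fun e => h' (congrArg _ e))
        · exact (combStk_fst_of_ne (s₁ := fun _ => []) (fun e => h (congrArg (fun x => Sum.inr (Sum.inl x)) e))).symm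
        · rfl)
    exact this.mono (le_of_eq (congrArg (fun m => 2 * m + 1) (List.length_map _)))
  · have := runs_move (Γ := CombΓ Own h₁.tm h₂.tm) (τ := h₁.tm.σ × h₂.tm.σ)
      (k := .inr (.inr h₂.tm.k₁)) (j := .inl b) (dec := h₂.outputAlphabet) (f := id) (by simp)
      (S := combStk (Function.update (fun _ => []) a d₁.reverse) (fun _ => [])
        (Function.update (fun _ => []) h₂.tm.k₁ y₂))
      (S' := combStk (Function.update (Function.update (fun _ => []) a d₁.reverse) b d₂.reverse)
        (fun _ => []) (fun _ => []))
      combStk_snd_self rfl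
      (combStk_own_self.trans (show d₂.reverse =
        (List.map (fun a => h₂.outputAlphabet a) y₂).reverse ++
          Function.update (β := fun _ : Own => List Sym) (fun _ => []) a d₁.reverse b by
          simp [hy₂, Function.comp_def, hab.symm])) (by
        rintro (j | j | j) h h'
        · exact combStk_own_of_ne (o := Function.update _ _ _) (fun e => h' (congrArg _ e))
        · rfl
        · exact (combStk_snd_of_ne (s₂ := fun _ => []) (fun e => h (congrArg (fun x => Sum.inr (Sum.inr x)) e))).symm)
    exact this.mono (le_of_eq (congrArg (fun m => 2 * m + 1) (List.length_map _)))
  · refine runs_within Sum.inl_injective (fun _ _ => rfl) (hP _) ?_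
    rintro (j | j | j) hj
    · exact (hj ⟨j, rfl⟩).elim
    · rfl
    · rfl

/-- An output cannot be longer than the initial content of the output stack plus everything that can
be pushed in `t` steps. -/
theorem length_output_le {h : TM2ComputableAux Bool Sym} {n t : ℕ} {d : List Sym}
    (H : Nonempty (TM2OutputsInTime h.tm (List.map h.inputAlphabet.invFun
      (Computability.unaryEncodeNat n)) (some (d.map h.outputAlphabet.invFun)) t)) :
    d.length ≤ n + t * ∑ l, pushCount ((ofTM h.tm).code l) := by
  obtain ⟨H⟩ := H
  have e := H.evals_in_steps
  simp only [Option.map_some, initList_eq, haltList_eq, unaryEncodeNat_eq, List.map_replicate]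
    at e
  have := (halts_ofTM _ _ _ _ _ _ _ e).length_le h.tm.k₁
  rw [Function.update_self, List.length_map] at this
  refine this.trans (Nat.add_le_add ?_ (Nat.mul_le_mul_right _ H.steps_le_m))
  -- The output stack may coincide with the input stack, and then it starts with `n` symbols;
  -- otherwise it starts empty.
  by_cases hk : h.tm.k₁ = h.tm.k₀
  · rw [hk]; simp
  · rw [Function.update_of_ne hk]; simp

attribute [local instance] FinTM2.kFin FinTM2.σFin FinTM2.Γk₀Fin

/-- A function that a program computes from two polynomial-time computable descriptions, in time
polynomial in the length of these, is polynomial-time computable. -/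
theorem PolyTime.combine [Fintype Own] {F₁ F₂ F : ℕ → List Sym} (h₁ : PolyTime F₁)
    (h₂ : PolyTime F₂) {a b out : Own} (hab : a ≠ b)
    (P : Frag (fun _ : Own => Sym) (Unit × Option Sym)) (q : Polynomial ℕ)
    (hP : ∀ n, P.Runs
      (Function.update (Function.update (fun _ => []) a (F₁ n).reverse) b (F₂ n).reverse)
      (q.eval ((F₁ n).length + (F₂ n).length)) (Function.update (fun _ => []) out (F n))) :
    PolyTime F := by
  obtain ⟨h₁⟩ := h₁
  obtain ⟨h₂⟩ := h₂
  -- `L₁` and `L₂` bound the lengths of the two outputs, so `q.comp (L₁ + L₂)` bounds the time of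
  -- `P` in terms of `n`.
  let L₁ : Polynomial ℕ := .X + h₁.time * .C (∑ l, pushCount ((ofTM h₁.tm).code l))
  let L₂ : Polynomial ℕ := .X + h₂.time * .C (∑ l, pushCount ((ofTM h₂.tm).code l))
  have hn : ∀ n, (Computability.unaryEncodeNat n).length = n := fun n => by
    rw [unaryEncodeNat_eq, List.length_replicate]
  have hL₁ : ∀ n, (F₁ n).length ≤ L₁.eval n := fun n => by
    have := length_output_le ⟨h₁.outputsFun n⟩
    simpa only [L₁, hn, id_eq, Polynomial.eval_add, Polynomial.eval_mul, Polynomial.eval_X,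
      Polynomial.eval_C] using this
  have hL₂ : ∀ n, (F₂ n).length ≤ L₂.eval n := fun n => by
    have := length_output_le ⟨h₂.outputsFun n⟩
    simpa only [L₂, hn, id_eq, Polynomial.eval_add, Polynomial.eval_mul, Polynomial.eval_X,
      Polynomial.eval_C] using this
  refine ⟨{
    tm := (QEnc.combine h₁.toTM2ComputableAux h₂.toTM2ComputableAux a b P).toTM
      (.inr (.inl h₁.tm.k₀)) (.inl out) ((h₁.tm.initialState, h₂.tm.initialState), none)
      (inferInstanceAs (Fintype (h₁.tm.Γ h₁.tm.k₀)))
    inputAlphabet := h₁.inputAlphabet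
    outputAlphabet := Equiv.refl Sym
    -- The constant is the `7` of `runs_combine` plus the clean-up step of `toTM`.
    time := 4 * .X + h₁.time + h₂.time + 2 * L₁ + 2 * L₂ + q.comp (L₁ + L₂) + 8
    outputsFun := fun n => Classical.choice ?_ }⟩
  obtain ⟨m, hm, v, h⟩ := runs_combine hab ⟨h₁.outputsFun n⟩ ⟨h₂.outputsFun n⟩ (hP n)
    ((h₁.tm.initialState, h₂.tm.initialState), none)
  refine ⟨⟨⟨m + 1, ?_⟩, ?_⟩⟩
  · rw [show F n = List.map (Equiv.refl Sym).invFun (id (F n)) from (List.map_id _).symm] at h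
    have e := iterate_toTM _ (.inr (.inl h₁.tm.k₀)) (.inl out)
      ((h₁.tm.initialState, h₂.tm.initialState), none)
      (inferInstanceAs (Fintype (h₁.tm.Γ h₁.tm.k₀))) h
    rw [combStk_update_left, combStk_update_right] at e
    simp only [Option.map_some, initList_eq, haltList_eq]
    exact e
  · have h₃ : q.eval ((F₁ n).length + (F₂ n).length) ≤ q.eval (L₁.eval n + L₂.eval n) :=
      eval_mono q (Nat.add_le_add (hL₁ n) (hL₂ n))
    have h₄ := hL₁ n
    have h₅ := hL₂ n
    rw [hn] at hm
    simp only [hn, Polynomial.eval_add, Polynomial.eval_mul, Polynomial.eval_X,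
      Polynomial.eval_comp, Polynomial.eval_ofNat]
    simp only [id_eq] at hm
    lia

end Combine

end QEnc

namespace QEnc

open Frag

/-! ### Two transformations of circuit descriptions -/

/-- The stacks of the programs below. -/
inductive Reg
  | out | a | b | x | w | c | d | h | g
  deriving DecidableEq

instance : Fintype Reg :=
  ⟨{.out, .a, .b, .x, .w, .c, .d, .h, .g}, by intro k; cases k <;> simp⟩

/-- Programs on these stacks. -/
abbrev RegFrag : Type 1 := Frag (fun _ : Reg => Sym) (Unit × Option Sym)

/-- The contents of the stacks. -/
def regs (out a b x w c d h g : List Sym) : Reg → List Sym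
  | .out => out
  | .a => a
  | .b => b
  | .x => x
  | .w => w
  | .c => c
  | .d => d
  | .h => h
  | .g => g

/-- No symbol stops the loop. -/
abbrev never : Sym → Bool := fun _ => false

/-- The symbols that end a number. -/
def isSep : Sym → Bool
  | .sep => true
  | _ => false

/-- The symbols that stand for a measurement gate. -/
def isMeas : Sym → Bool
  | .measure => true
  | _ => false

/-- A loop with a simple body. -/
noncomputable abbrev rloop (k : Reg) (quit : Sym → Bool) (L : Sym → List (Σ _ : Reg, Sym)) : RegFrag :=
  loop k id quit fun s => pushes (L s)

theorem flatMap_ite_replicate {α β : Type} (l : List α) (p : α → Bool) (m : ℕ) (z : β) :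
    (l.flatMap fun a => if p a = true then List.replicate m z else []) =
      List.replicate (l.countP p * m) z := by
  induction l with
  | nil => simp
  | cons a l ih =>
    rw [List.flatMap_cons, ih, List.countP_cons]
    cases p a
    · simp
    · simp [Nat.add_mul, Nat.add_comm]

theorem flatMap_const_replicate {α β : Type} (l : List α) (m : ℕ) (z : β) :
    (l.flatMap fun _ => List.replicate m z) = List.replicate (l.length * m) z := by
  simpa using flatMap_ite_replicate l (fun _ => true) m z

/-! ### Writing gates that set wires -/

/-- Write the name of a gate on one wire, the number of the wire being on stack `c`. -/
noncomputable def emitGate (m : Sym) : RegFrag :=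
  seq (pushes [⟨.out, .sep⟩]) <|
  seq (rloop .c never fun s => [⟨.out, s⟩, ⟨.d, s⟩]) <|
  seq (rloop .d never fun s => [⟨.c, s⟩]) <|
  pushes [⟨.out, m⟩]

/-- Text on `out` is produced from back to front: separator, ticks, name. Copying the wire number
empties `c`, so a second copy goes to `d` and is moved back. -/
theorem runs_emitGate (m : Sym) (out a b x w h g : List Sym) (j : ℕ) :
    (emitGate m).Runs (regs out a b x w (List.replicate j .tick) [] h g) (4 * j + 4)
      (regs (m :: natSyms j ++ out) a b x w (List.replicate j .tick) [] h g) := by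
  refine (Runs.seq (t := 1)
    (S' := regs (.sep :: out) a b x w (List.replicate j .tick) [] h g) ?_ <|
    Runs.seq (t := 2 * j + 1)
    (S' := regs (natSyms j ++ out) a b x w [] (List.replicate j .tick) h g) ?_ <|
    Runs.seq (t := 2 * j + 1) (t' := 1)
    (S' := regs (natSyms j ++ out) a b x w (List.replicate j .tick) [] h g) ?_ ?_).mono (by lia)
  · refine runs_pushes' fun i => ?_
    cases i <;> simp [onStack, regs]
  · refine runs_loop_pushes (r := []) (rest := []) (as := List.replicate j .tick) ?_ (by simp [regs])
      (fun _ _ => rfl) (.inl ⟨rfl, rfl⟩) rfl (fun i hi => ?_) (by simp)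
    · intro s; simp [onStack]
    · cases i <;> simp [onStack, regs, natSyms] at hi ⊢
  · refine runs_loop_pushes (r := []) (rest := []) (as := List.replicate j .tick) ?_ (by simp [regs])
      (fun _ _ => rfl) (.inl ⟨rfl, rfl⟩) rfl (fun i hi => ?_) (by simp)
    · intro s; simp [onStack]
    · cases i <;> simp [onStack, regs, natSyms] at hi ⊢
  · refine runs_pushes' fun i => ?_
    cases i <;> simp [onStack, regs]

/-- The symbol that stands for a bit on stack `w`. -/
def bitSym : Bool → Sym
  | true => .X
  | false => .tick

/-- The description of gates that set wires `j, j + 1, …` to the given bits (starting with the last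
of these wires). -/
def setSyms : ℕ → List Bool → List Sym
  | _, [] => []
  | j, b :: l => setSyms (j + 1) l ++ (.reset :: natSyms j ++ if b then .X :: natSyms j else [])

/-- Write the gates that set the next wire, and increase the number of the wire. -/
noncomputable def emitBit : Sym → RegFrag
  | .X => seq (emitGate .X) (seq (emitGate .reset) (pushes [⟨.c, .tick⟩]))
  | _ => seq (emitGate .reset) (pushes [⟨.c, .tick⟩])

/-- What is pushed later is read earlier. Thus `X` is written before `reset`, although in the
circuit the reset comes first. -/
theorem runs_emitBit (β : Bool) (out a b x w h g : List Sym) (j : ℕ) :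
    (emitBit (bitSym β)).Runs (regs out a b x w (List.replicate j .tick) [] h g) (8 * j + 9)
      (regs ((.reset :: natSyms j ++ if β then .X :: natSyms j else []) ++ out) a b x w
        (List.replicate (j + 1) .tick) [] h g) := by
  have fin : ∀ out, (pushes (σ := Unit × Option Sym) [⟨Reg.c, Sym.tick⟩]).Runs
      (regs out a b x w (List.replicate j .tick) [] h g) 1
      (regs out a b x w (List.replicate (j + 1) .tick) [] h g) := fun out => by
    refine runs_pushes' fun i => ?_
    cases i <;> simp [onStack, regs, List.replicate_succ]
  cases β
  · simpa [bitSym, emitBit] using ((runs_emitGate .reset out a b x w h g j).seq (fin _)).mono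
      (show 4 * j + 4 + 1 ≤ 8 * j + 9 by lia)
  · simpa [bitSym, emitBit] using ((runs_emitGate .X out a b x w h g j).seq
      ((runs_emitGate .reset _ a b x w h g j).seq (fin _))).mono
      (show 4 * j + 4 + (4 * j + 4 + 1) ≤ 8 * j + 9 by lia)

/-- The wires are treated in increasing order, so on the stack the last wire ends up on top; this
explains the order in `setSyms`. The bound is quadratic because each gate costs time linear in its
wire number. -/
theorem runs_emitBits (l : List Bool) (out a b x h g : List Sym) (j : ℕ) :
    (loop .w id never emitBit).Runs
      (regs out a b x (l.map bitSym) (List.replicate j .tick) [] h g)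
      (l.length * (8 * (j + l.length) + 10) + 1)
      (regs (setSyms j l ++ out) a b x [] (List.replicate (j + l.length) .tick) [] h g) := by
  induction l generalizing out j with
  | nil => simpa [setSyms] using runs_loop_nil rfl
  | cons β l ih =>
    have := runs_loop_cons (dec := id) (quit := never) (body := emitBit) (k := Reg.w)
      (Γ := fun _ => Sym) (S := regs out a b x (bitSym β :: l.map bitSym)
        (List.replicate j .tick) [] h g) (a := bitSym β) rfl rfl
      (S' := regs ((.reset :: natSyms j ++ if β then .X :: natSyms j else []) ++ out) a b x
        (l.map bitSym) (List.replicate (j + 1) .tick) [] h g)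
      (t := 8 * j + 9) (by
        convert runs_emitBit β out a b x (l.map bitSym) h g j using 1
        · rfl
        · funext i
          cases i <;> simp [regs]) (ih _ (j + 1))
    rw [List.map_cons, setSyms, List.append_assoc, List.length_cons, ← Nat.add_assoc,
      Nat.add_right_comm]
    refine this.mono ?_
    nlinarith

/-- Write the gates that set all the wires. -/
noncomputable def emit : RegFrag :=
  seq (loop .w id never emitBit) (rloop .c never fun _ => [])

theorem runs_emit (l : List Bool) (out a b x h g : List Sym) :
    emit.Runs (regs out a b x (l.map bitSym) [] [] h g)
      (l.length * (8 * l.length + 10) + 2 * l.length + 2)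
      (regs (setSyms 0 l ++ out) a b x [] [] [] h g) := by
  have h₁ := runs_emitBits l out a b x h g 0
  rw [Nat.zero_add] at h₁
  refine (Runs.seq h₁ (t' := 2 * l.length + 1) ?_).mono (by lia)
  refine runs_loop_pushes (r := []) (rest := []) (as := List.replicate l.length .tick) ?_
    (by simp [regs]) (fun _ _ => rfl) (.inl ⟨rfl, rfl⟩) rfl (fun i hi => ?_) (by simp)
  · intro s; rfl
  · cases i <;> simp [onStack, regs] at hi ⊢

theorem regs_eq_update_out (l : List Sym) :
    regs l [] [] [] [] [] [] [] [] = Function.update (fun _ => []) .out l := by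
  funext i
  cases i <;> simp [regs]

theorem regs_eq_update_ab (l l' : List Sym) :
    regs [] l l' [] [] [] [] [] [] =
      Function.update (Function.update (fun _ => []) .a l) .b l' := by
  funext i
  cases i <;> simp [regs]

theorem natSyms_append (n : ℕ) (l : List Sym) :
    natSyms n ++ l = List.replicate n .tick ++ .sep :: l := by
  simp [natSyms]

/-! ### Appending resets to a description -/

/-- Append, to the description on stack `a`, gates that reset the first `m` wires, where `m` is the
third number in the description on stack `b` (both descriptions being in reverse order). -/
noncomputable def appendResets : RegFrag :=
  seq (rloop .b never fun s => [⟨.x, s⟩]) <|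
  seq (rloop .x isSep fun _ => []) <|
  seq (rloop .x isSep fun _ => []) <|
  seq (rloop .x isSep fun _ => [⟨.w, .tick⟩]) <|
  seq (rloop .x never fun _ => []) <|
  seq emit <|
  rloop .a never fun s => [⟨.out, s⟩]

/-- Moving `b` to `x` undoes the reversal, so the three leading numbers can be read in order. The
ticks of `m` become bits `false` on `w`. The resets are written before `d` is moved on top of them,
since `out` grows towards the front. -/
theorem runs_appendResets (d : List Sym) (p q m : ℕ) (rest : List Sym) :
    appendResets.Runs
      (regs [] d.reverse (natSyms p ++ natSyms q ++ natSyms m ++ rest).reverse [] [] [] [] [] [])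
      (8 * m * m + 16 * m + 4 * p + 4 * q + 4 * rest.length + 2 * d.length + 20)
      (regs (d ++ setSyms 0 (List.replicate m false)) [] [] [] [] [] [] [] []) := by
  refine (Runs.seq (t := 2 * (p + q + m + rest.length + 3) + 1)
    (S' := regs [] d.reverse [] (natSyms p ++ (natSyms q ++ (natSyms m ++ rest))) [] [] [] [] [])
      ?_ <|
    Runs.seq (t := 2 * p + 1)
    (S' := regs [] d.reverse [] (natSyms q ++ (natSyms m ++ rest)) [] [] [] [] []) ?_ <|
    Runs.seq (t := 2 * q + 1)
    (S' := regs [] d.reverse [] (natSyms m ++ rest) [] [] [] [] []) ?_ <|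
    Runs.seq (t := 2 * m + 1)
    (S' := regs [] d.reverse [] rest ((List.replicate m false).map bitSym) [] [] [] []) ?_ <|
    Runs.seq (t := 2 * rest.length + 1)
    (S' := regs [] d.reverse [] [] ((List.replicate m false).map bitSym) [] [] [] []) ?_ <|
    Runs.seq (runs_emit _ _ _ _ _ _ _) (t' := 2 * d.length + 1) ?_).mono ?_
  · refine runs_loop_pushes (r := []) (rest := []) ?_ (List.append_nil _).symm
      (fun _ _ => rfl) (.inl ⟨rfl, rfl⟩) rfl (fun i hi => ?_) ?_
    · intro s; simp [onStack]
    · cases i <;> simp [onStack, regs] at hi ⊢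
    · simp [regs, natSyms]; lia
  · refine runs_loop_pushes (r := .sep :: (natSyms q ++ (natSyms m ++ rest)))
      (as := List.replicate p .tick) (fun _ => rfl) (natSyms_append _ _) ?_
      (.inr ⟨_, rfl, rfl⟩) rfl (fun i hi => ?_) (by simp)
    · intro s hs; rw [List.eq_of_mem_replicate hs]; rfl
    · cases i <;> simp [onStack, regs] at hi ⊢
  · refine runs_loop_pushes (r := .sep :: (natSyms m ++ rest))
      (as := List.replicate q .tick) (fun _ => rfl) (natSyms_append _ _) ?_
      (.inr ⟨_, rfl, rfl⟩) rfl (fun i hi => ?_) (by simp)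
    · intro s hs; rw [List.eq_of_mem_replicate hs]; rfl
    · cases i <;> simp [onStack, regs] at hi ⊢
  · refine runs_loop_pushes (r := .sep :: rest)
      (as := List.replicate m .tick) (fun _ => rfl) (natSyms_append _ _) ?_
      (.inr ⟨_, rfl, rfl⟩) rfl (fun i hi => ?_) (by simp)
    · intro s hs; rw [List.eq_of_mem_replicate hs]; rfl
    · cases i <;> simp [onStack, regs, bitSym] at hi ⊢
      simpa using (flatMap_const_replicate (List.replicate m Sym.tick) 1 Sym.tick).symm
  · refine runs_loop_pushes (r := []) (rest := []) (fun _ => rfl) (List.append_nil _).symm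
      (fun _ _ => rfl) (.inl ⟨rfl, rfl⟩) rfl (fun i hi => ?_) rfl
    cases i <;> simp [onStack, regs] at hi ⊢
  · refine runs_loop_pushes (r := []) (rest := []) ?_ (List.append_nil _).symm
      (fun _ _ => rfl) (.inl ⟨rfl, rfl⟩) rfl (fun i hi => ?_) ?_
    · intro s; simp [onStack]
    · cases i <;> simp [onStack, regs] at hi ⊢
    · simp [regs]
  · simp only [List.length_replicate]
    nlinarith

theorem PolyTime.appendResets {F₁ F₂ : ℕ → List Sym} (h₁ : PolyTime F₁) (h₂ : PolyTime F₂)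
    {p q m : ℕ → ℕ} {rest : ℕ → List Sym}
    (hF₂ : ∀ n, F₂ n = natSyms (p n) ++ natSyms (q n) ++ natSyms (m n) ++ rest n) :
    PolyTime fun n => F₁ n ++ setSyms 0 (List.replicate (m n) false) := by
  refine h₁.combine h₂ (a := .a) (b := .b) (out := .out) (by simp) QEnc.appendResets
    (8 * .X * .X + 16 * .X + 20) fun n => ?_
  rw [← regs_eq_update_out, ← regs_eq_update_ab, hF₂]
  refine (runs_appendResets _ _ _ _ _).mono ?_
  simp only [Polynomial.eval_add, Polynomial.eval_mul, Polynomial.eval_X, Polynomial.eval_ofNat,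
    List.length_append, natSyms, List.length_replicate, List.length_singleton]
  -- The only nonlinear term of the running time; with this product bounded, the rest is linear
  -- arithmetic.
  have : m n * m n ≤ ((F₁ n).length + (p n + 1 + (q n + 1) + (m n + 1) + (rest n).length)) *
      ((F₁ n).length + (p n + 1 + (q n + 1) + (m n + 1) + (rest n).length)) :=
    Nat.mul_le_mul (by lia) (by lia)
  lia

/-! ### Describing a circuit that outputs a constant function -/

/-- The description of the circuit with `N` inputs and constant output `1`. -/
def constBits (N : ℕ) : List Bool :=
  natBits N ++ natBits 1 ++ [false, true] ++ natBits 1 ++ natBits N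

/-- From a description on stack `a`, in reverse order, with first number `k` and `N` measurement
gates, write the description of a circuit that writes `constBits N`. -/
noncomputable def describeConst : RegFrag :=
  seq (rloop .b never fun _ => []) <|
  seq (rloop .a never fun s => [⟨.x, s⟩]) <|
  seq (rloop .x isSep fun _ => [⟨.w, .tick⟩, ⟨.h, .tick⟩, ⟨.g, .tick⟩]) <|
  seq (pushes [⟨.w, .tick⟩]) <|
  seq (rloop .x never fun s => if isMeas s = true then
    [⟨.w, .X⟩, ⟨.b, .X⟩, ⟨.a, .tick⟩, ⟨.a, .tick⟩, ⟨.g, .tick⟩, ⟨.g, .tick⟩] else []) <|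
  seq (pushes (([.tick, .X, .tick, .tick, .X, .X, .tick].map fun s => ⟨.w, s⟩) ++
    List.replicate 8 ⟨.a, .tick⟩ ++ List.replicate 8 ⟨.g, .tick⟩)) <|
  seq (rloop .b never fun s => [⟨.w, s⟩]) <|
  seq emit <|
  seq (pushes [⟨.out, .sep⟩]) <|
  seq (rloop .g never fun s => [⟨.out, s⟩]) <|
  seq (pushes [⟨.out, .sep⟩]) <|
  seq (rloop .a never fun s => [⟨.out, s⟩]) <|
  seq (pushes [⟨.out, .sep⟩]) <|
  rloop .h never fun s => [⟨.out, s⟩]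

/-- The output of that program. -/
def constSyms (k N : ℕ) : List Sym :=
  natSyms k ++ natSyms (2 * N + 8) ++ natSyms (k + (2 * N + 8)) ++
    setSyms 0 (constBits N ++ List.replicate k false)

/-- The bits to be written are collected on `w` from last to first, while `h`, `a` and `g`
accumulate the numbers `k`, `2 * N + 8` and their sum in unary for the header. The header is written
after the gates because `out` grows towards the front. Stack `b` remembers `N` for the second
occurrence of `natBits N`. -/
theorem runs_describeConst (l : List Sym) (k : ℕ) (rest : List Sym) :
    describeConst.Runs
      (regs [] (natSyms k ++ rest).reverse l [] [] [] [] [] [])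
      (2 * l.length + 4 * rest.length + 12 * rest.countP isMeas + 10 * k + 60 +
        (2 * rest.countP isMeas + 8 + k) * (8 * (2 * rest.countP isMeas + 8 + k) + 12))
      (regs (constSyms k (rest.countP isMeas)) [] [] [] [] [] [] [] []) := by
  set N := rest.countP isMeas with hN
  -- The seven middle symbols are the terminator of the first `natBits N`, then `natBits 1`, the
  -- gate `[false, true]`, and `natBits 1` again. The `k` final ticks are padding.
  have hw : (constBits N ++ List.replicate k false).map bitSym =
      List.replicate N .X ++ ([.tick, .X, .tick, .tick, .X, .X, .tick] ++
        (List.replicate N .X ++ .tick :: List.replicate k .tick)) := by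
    simp [constBits, natBits, bitSym]
  have hl : (constBits N ++ List.replicate k false).length = 2 * N + 8 + k := by
    simp [constBits, natBits]; lia
  set W := constBits N ++ List.replicate k false with hW
  set ts := fun n : ℕ => List.replicate n Sym.tick with hts
  have hcount : ∀ m (z : Sym), (rest.reverse.flatMap fun s =>
      if isMeas s = true then List.replicate m z else []) = List.replicate (N * m) z := by
    intro m z
    rw [flatMap_ite_replicate, List.countP_reverse]
  refine (Runs.seq (t := 2 * l.length + 1)
    (S' := regs [] (natSyms k ++ rest).reverse [] [] [] [] [] [] []) ?_ <|
    Runs.seq (t := 2 * (k + 1 + rest.length) + 1)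
    (S' := regs [] [] [] (natSyms k ++ rest) [] [] [] [] []) ?_ <|
    Runs.seq (t := 2 * k + 1)
    (S' := regs [] [] [] rest (ts k) [] [] (ts k) (ts k)) ?_ <|
    Runs.seq (t := 1)
    (S' := regs [] [] [] rest (.tick :: ts k) [] [] (ts k) (ts k)) ?_ <|
    Runs.seq (t := 2 * rest.length + 1)
    (S' := regs [] (ts (2 * N)) (List.replicate N .X) []
      (List.replicate N .X ++ .tick :: ts k) [] [] (ts k) (ts (2 * N + k))) ?_ <|
    Runs.seq (t := 1)
    (S' := regs [] (ts (2 * N + 8)) (List.replicate N .X) []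
      ([.tick, .X, .tick, .tick, .X, .X, .tick] ++ (List.replicate N .X ++ .tick :: ts k)) [] []
      (ts k) (ts (k + (2 * N + 8)))) ?_ <|
    Runs.seq (t := 2 * N + 1)
    (S' := regs [] (ts (2 * N + 8)) [] [] (W.map bitSym) [] [] (ts k) (ts (k + (2 * N + 8)))) ?_ <|
    Runs.seq (runs_emit _ _ _ _ _ _ _) <|
    Runs.seq (t := 1)
    (S' := regs (.sep :: setSyms 0 W) (ts (2 * N + 8)) [] [] [] [] [] (ts k)
      (ts (k + (2 * N + 8)))) ?_ <|
    Runs.seq (t := 2 * (k + (2 * N + 8)) + 1)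
    (S' := regs (ts (k + (2 * N + 8)) ++ .sep :: setSyms 0 W) (ts (2 * N + 8)) [] [] [] [] []
      (ts k) []) ?_ <|
    Runs.seq (t := 1)
    (S' := regs (.sep :: (ts (k + (2 * N + 8)) ++ .sep :: setSyms 0 W)) (ts (2 * N + 8)) [] [] []
      [] [] (ts k) []) ?_ <|
    Runs.seq (t := 2 * (2 * N + 8) + 1)
    (S' := regs (ts (2 * N + 8) ++ .sep :: (ts (k + (2 * N + 8)) ++ .sep :: setSyms 0 W)) [] [] []
      [] [] [] (ts k) []) ?_ <|
    Runs.seq (t := 1) (t' := 2 * k + 1)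
    (S' := regs (.sep :: (ts (2 * N + 8) ++ .sep :: (ts (k + (2 * N + 8)) ++ .sep :: setSyms 0 W)))
      [] [] [] [] [] [] (ts k) []) ?_ ?_).mono ?_
  · refine runs_loop_pushes (r := []) (rest := []) ?_ (List.append_nil _).symm
      (fun _ _ => rfl) (.inl ⟨rfl, rfl⟩) rfl (fun i hi => ?_) rfl
    · intro s; simp [onStack]
    · cases i <;> simp [onStack, regs] at hi ⊢
  · refine runs_loop_pushes (r := []) (rest := []) ?_ (List.append_nil _).symm
      (fun _ _ => rfl) (.inl ⟨rfl, rfl⟩) rfl (fun i hi => ?_) ?_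
    · intro s; simp [onStack]
    · cases i <;> simp [onStack, regs] at hi ⊢
    · simp [regs, natSyms]; lia
  · refine runs_loop_pushes (r := .sep :: rest)
      (as := List.replicate k .tick) ?_ (natSyms_append _ _) ?_
      (.inr ⟨_, rfl, rfl⟩) rfl (fun i hi => ?_) (by simp)
    · intro s; simp [onStack]
    · intro s hs; rw [List.eq_of_mem_replicate hs]; rfl
    · have := (flatMap_const_replicate (List.replicate k Sym.tick) 1 Sym.tick).symm
      cases i <;> simp [onStack, regs] at hi this ⊢ <;> exact this
  · refine runs_pushes' fun i => ?_
    cases i <;> simp [onStack, regs]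
  · refine runs_loop_pushes (r := []) (rest := []) ?_ (List.append_nil _).symm
      (fun _ _ => rfl) (.inl ⟨rfl, rfl⟩) rfl (fun i hi => ?_) rfl
    · intro s
      cases isMeas s <;> simp [onStack]
    · have e : ∀ (i : Reg) (L : List (Σ _ : Reg, Sym)) (s : Sym),
          onStack i (if isMeas s = true then L else []) =
            if isMeas s = true then onStack i L else [] := fun i L s => by
        cases isMeas s <;> simp [onStack]
      have h := hcount 1
      have h' := hcount 2
      simp only [Nat.mul_one, Nat.mul_comm N 2, List.replicate_succ,
        List.replicate_zero] at h h'
      simp only [id_eq, e]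
      cases i <;> simp [onStack, regs, hts, h, h'] at hi ⊢
  · refine runs_pushes' fun i => ?_
    cases i <;> simp [onStack, regs, hts, ← List.replicate_succ]
    lia
  · refine runs_loop_pushes (r := []) (rest := []) (as := List.replicate N .X) ?_
      (List.append_nil _).symm (fun _ _ => rfl) (.inl ⟨rfl, rfl⟩) rfl (fun i hi => ?_) (by simp)
    · intro s; simp [onStack]
    · cases i <;> simp [onStack, regs, hw, hts] at hi ⊢
  · refine runs_pushes' fun i => ?_
    cases i <;> simp [onStack, regs]
  · refine runs_loop_pushes (r := []) (rest := []) (as := ts (k + (2 * N + 8))) ?_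
      (List.append_nil _).symm (fun _ _ => rfl) (.inl ⟨rfl, rfl⟩) rfl (fun i hi => ?_)
      (by simp [hts])
    · intro s; simp [onStack]
    · cases i <;> simp [onStack, regs, hts] at hi ⊢
  · refine runs_pushes' fun i => ?_
    cases i <;> simp [onStack, regs]
  · refine runs_loop_pushes (r := []) (rest := []) (as := ts (2 * N + 8)) ?_
      (List.append_nil _).symm (fun _ _ => rfl) (.inl ⟨rfl, rfl⟩) rfl (fun i hi => ?_)
      (by simp [hts])
    · intro s; simp [onStack]
    · cases i <;> simp [onStack, regs, hts] at hi ⊢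
  · refine runs_pushes' fun i => ?_
    cases i <;> simp [onStack, regs]
  · refine runs_loop_pushes (r := []) (rest := []) (as := ts k) ?_
      (List.append_nil _).symm (fun _ _ => rfl) (.inl ⟨rfl, rfl⟩) rfl (fun i hi => ?_)
      (by simp [hts])
    · intro s; simp [onStack]
    · cases i <;> simp [onStack, regs, hts, constSyms, natSyms, hW] at hi ⊢
  · rw [hl]
    linarith [Nat.mul_add (2 * N + 8 + k) (8 * (2 * N + 8 + k) + 10) 2]

/-- Only one description is needed; the two-machine construction is used with `F` twice, and the
program discards the copy on `b`. -/
theorem PolyTime.describeConst {F : ℕ → List Sym} (hF : PolyTime F) {k : ℕ → ℕ}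
    {rest : ℕ → List Sym} (h : ∀ n, F n = natSyms (k n) ++ rest n) :
    PolyTime fun n => constSyms (k n) ((rest n).countP isMeas) := by
  refine hF.combine hF (a := .a) (b := .b) (out := .out) (by simp) QEnc.describeConst
    (30 * .X + 60 + (2 * .X + 8) * (8 * (2 * .X + 8) + 12)) fun n => ?_
  rw [← regs_eq_update_out, ← regs_eq_update_ab]
  nth_rw 1 [h]
  refine (runs_describeConst _ _ _).mono ?_
  simp only [Polynomial.eval_add, Polynomial.eval_mul, Polynomial.eval_X, Polynomial.eval_ofNat]
  have h₁ : (F n).length = k n + 1 + (rest n).length := by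
    rw [h]; simp [natSyms]; lia
  have h₂ : (rest n).countP isMeas ≤ (rest n).length := List.countP_le_length
  rw [List.length_reverse]
  have h₃ : 2 * (rest n).countP isMeas + 8 + k n ≤ 2 * ((F n).length + (F n).length) + 8 := by
    lia
  have h₄ := Nat.mul_le_mul h₃ (Nat.add_le_add_right (Nat.mul_le_mul_left 8 h₃) 12)
  lia

end QEnc

namespace QEnc

open scoped ComplexOrder Matrix

set_option linter.unusedSectionVars false

/-! ### Completely positive trace-preserving maps -/

section Channel

variable {α β γ δ : Type} [Fintype α] [Fintype β] [Fintype γ] [Fintype δ]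

/-- `Φ ⊗ 𝟙`. -/
def ampl (γ : Type) (Φ : Matrix α α ℂ → Matrix β β ℂ) (ρ : Matrix (α × γ) (α × γ) ℂ) :
    Matrix (β × γ) (β × γ) ℂ :=
  fun s t => Φ (fun p q => ρ (p, s.2) (q, t.2)) s.1 t.1

/-- Additive, completely positive maps. -/
structure IsCP (Φ : Matrix α α ℂ → Matrix β β ℂ) : Prop where
  map_add : ∀ ρ σ, Φ (ρ + σ) = Φ ρ + Φ σ
  posSemidef : ∀ (γ : Type) [Fintype γ] (ρ : Matrix (α × γ) (α × γ) ℂ), ρ.PosSemidef →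
    (ampl γ Φ ρ).PosSemidef

theorem IsCP.congr {Φ Ψ : Matrix α α ℂ → Matrix β β ℂ} (h : IsCP Φ) (e : ∀ ρ s t, Ψ ρ s t = Φ ρ s t) :
    IsCP Ψ := by
  have : Ψ = Φ := funext fun ρ => Matrix.ext (e ρ)
  rwa [this]

theorem IsCP.map_zero {Φ : Matrix α α ℂ → Matrix β β ℂ} (h : IsCP Φ) : Φ 0 = 0 := by
  have := h.map_add 0 0
  rwa [add_zero, left_eq_add] at this

theorem IsCP.map_sum {Φ : Matrix α α ℂ → Matrix β β ℂ} (h : IsCP Φ) {ι : Type} (s : Finset ι)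
    (ρ : ι → Matrix α α ℂ) : Φ (∑ i ∈ s, ρ i) = ∑ i ∈ s, Φ (ρ i) := by
  classical
  induction s using Finset.induction_on with
  | empty => simp [h.map_zero]
  | insert i s hi ih => rw [Finset.sum_insert hi, Finset.sum_insert hi, h.map_add, ih]

theorem IsCP.apply {Φ : Matrix α α ℂ → Matrix β β ℂ} (h : IsCP Φ) {ρ : Matrix α α ℂ}
    (hρ : ρ.PosSemidef) : (Φ ρ).PosSemidef :=
  (h.posSemidef Unit (ρ.submatrix Prod.fst Prod.fst) (hρ.submatrix _)).submatrix fun s => (s, ())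

theorem IsCP.comp {Ψ : Matrix β β ℂ → Matrix γ γ ℂ} {Φ : Matrix α α ℂ → Matrix β β ℂ}
    (hΨ : IsCP Ψ) (hΦ : IsCP Φ) : IsCP fun ρ => Ψ (Φ ρ) where
  map_add ρ σ := by rw [hΦ.map_add, hΨ.map_add]
  posSemidef δ _ ρ hρ := hΨ.posSemidef δ _ (hΦ.posSemidef δ ρ hρ)

theorem IsCP.submatrix (f : β → α) : IsCP fun ρ : Matrix α α ℂ => ρ.submatrix f f where
  map_add _ _ := rfl
  posSemidef _ _ _ hρ := hρ.submatrix fun s : β × _ => (f s.1, s.2)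

theorem IsCP.sum {ι : Type} (s : Finset ι) {Φ : ι → Matrix α α ℂ → Matrix β β ℂ}
    (h : ∀ i ∈ s, IsCP (Φ i)) : IsCP fun ρ => ∑ i ∈ s, Φ i ρ where
  map_add ρ σ := by
    rw [← Finset.sum_add_distrib]
    exact Finset.sum_congr rfl fun i hi => (h i hi).map_add ρ σ
  posSemidef γ _ ρ hρ := by
    have : ampl γ (fun ρ => ∑ i ∈ s, Φ i ρ) ρ = ∑ i ∈ s, ampl γ (Φ i) ρ := by
      ext x y
      simp [ampl, Matrix.sum_apply]
    rw [this]
    exact Matrix.posSemidef_sum s fun i hi => (h i hi).posSemidef γ ρ hρ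

/-- The amplification is conjugation by `U ⊗ 1`, and conjugation preserves positivity. -/
theorem IsCP.conj (U : Matrix β α ℂ) : IsCP fun ρ : Matrix α α ℂ => U * ρ * Uᴴ where
  map_add ρ σ := by rw [Matrix.mul_add, Matrix.add_mul]
  posSemidef γ _ ρ hρ := by
    classical
    have : ampl γ (fun ρ : Matrix α α ℂ => U * ρ * Uᴴ) ρ =
        Matrix.kroneckerMap (· * ·) U (1 : Matrix γ γ ℂ) * ρ *
          (Matrix.kroneckerMap (· * ·) U (1 : Matrix γ γ ℂ))ᴴ := by
      ext x y
      change (U * Matrix.of (fun p q => ρ (p, x.2) (q, y.2)) * Uᴴ) x.1 y.1 = _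
      simp [Matrix.mul_apply, Fintype.sum_prod_type, Matrix.one_apply,
        Matrix.conjTranspose_apply, Finset.sum_mul, apply_ite (starRingEnd ℂ)]
    rw [this]
    exact hρ.mul_mul_conjTranspose_same _

/-- This is conjugation by the diagonal projection onto `P`. -/
theorem IsCP.mask (P : α → Prop) [DecidablePred P] :
    IsCP fun (ρ : Matrix α α ℂ) (s t : α) => if P s ∧ P t then ρ s t else 0 := by
  classical
  refine (IsCP.conj (Matrix.diagonal fun s : α => if P s then (1 : ℂ) else 0)).congr fun ρ s t => ?_
  rw [Matrix.diagonal_conjTranspose, Matrix.mul_diagonal, Matrix.diagonal_mul]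
  by_cases hs : P s <;> by_cases ht : P t <;> simp [hs, ht]

theorem IsCP.ampl {Φ : Matrix α α ℂ → Matrix β β ℂ} (h : IsCP Φ) :
    IsCP (QEnc.ampl γ Φ) where
  map_add ρ σ := by
    ext s t
    exact congrFun₂ (h.map_add (fun p q => ρ (p, s.2) (q, t.2)) fun p q => σ (p, s.2) (q, t.2))
      s.1 t.1
  posSemidef δ _ ρ hρ :=
    (h.posSemidef (γ × δ) (ρ.submatrix (fun x => ((x.1, x.2.1), x.2.2)) _)
      (hρ.submatrix _)).submatrix
      fun x : (β × γ) × δ => (x.1.1, (x.1.2, x.2))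

/-- Completely positive trace-preserving maps. -/
structure IsChannel (Φ : Matrix α α ℂ → Matrix β β ℂ) : Prop extends IsCP Φ where
  trace_eq : ∀ ρ, (Φ ρ).trace = ρ.trace

theorem IsChannel.id : IsChannel fun ρ : Matrix α α ℂ => ρ :=
  ⟨⟨fun _ _ => rfl, fun _ _ _ h => h⟩, fun _ => rfl⟩

theorem IsChannel.comp {Ψ : Matrix β β ℂ → Matrix γ γ ℂ} {Φ : Matrix α α ℂ → Matrix β β ℂ}
    (hΨ : IsChannel Ψ) (hΦ : IsChannel Φ) : IsChannel fun ρ => Ψ (Φ ρ) :=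
  ⟨hΨ.toIsCP.comp hΦ.toIsCP, fun ρ => (hΨ.trace_eq _).trans (hΦ.trace_eq ρ)⟩

theorem IsChannel.ampl {Φ : Matrix α α ℂ → Matrix β β ℂ} (h : IsChannel Φ) :
    IsChannel (QEnc.ampl γ Φ) := by
  refine ⟨h.toIsCP.ampl, fun ρ => ?_⟩
  simp only [Matrix.trace, Matrix.diag, Fintype.sum_prod_type_right, QEnc.ampl]
  exact Finset.sum_congr rfl fun x _ => h.trace_eq fun p q => ρ (p, x) (q, x)

theorem IsChannel.reindex (e : β ≃ α) : IsChannel fun ρ : Matrix α α ℂ => ρ.submatrix e e :=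
  ⟨.submatrix _, fun ρ => e.sum_comp fun i => ρ i i⟩

/-- The partial trace. -/
theorem IsChannel.sum_submatrix (f : γ → β → α)
    (hf : Function.Bijective fun x : γ × β => f x.1 x.2) :
    IsChannel fun ρ : Matrix α α ℂ => ∑ z, ρ.submatrix (f z) (f z) := by
  refine ⟨.sum _ fun z _ => .submatrix _, fun ρ => ?_⟩
  rw [Matrix.trace_sum]
  simp only [Matrix.trace, Matrix.diag, Matrix.submatrix_apply]
  rw [← Fintype.sum_prod_type' fun z s => ρ (f z s) (f z s)]
  exact hf.sum_comp fun i => ρ i i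

end Channel

/-! ### Registers -/

section Registers

variable {a a' b k w : ℕ}

theorem bijective_append : Function.Bijective fun x : Bits a × Bits b => Fin.append x.1 x.2 :=
  (Fin.appendEquiv a b).bijective

/-- A bitstring as a pair of two bitstrings. -/
def splitBits (a b : ℕ) (s : Bits (a + b)) : Bits a × Bits b :=
  (fun i => s (Fin.castAdd b i), fun j => s (Fin.natAdd a j))

theorem append_splitBits (s : Bits (a + b)) :
    Fin.append (splitBits a b s).1 (splitBits a b s).2 = s :=
  Fin.append_castAdd_natAdd

theorem splitBits_append (p : Bits a) (q : Bits b) : splitBits a b (Fin.append p q) = (p, q) := by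
  simp [splitBits]

/-- The equivalence between bitstrings and pairs of bitstrings. -/
def splitEquiv (a b : ℕ) : Bits (a + b) ≃ Bits a × Bits b where
  toFun := splitBits a b
  invFun x := Fin.append x.1 x.2
  left_inv := append_splitBits
  right_inv x := splitBits_append x.1 x.2

theorem isChannel_onFst {Φ : QMat a → QMat a'} (h : IsChannel Φ) :
    IsChannel fun ρ : QMat (a + b) => onFst Φ ρ :=
  (IsChannel.reindex (splitEquiv a' b)).comp <| (h.ampl (γ := Bits b)).comp <|
    IsChannel.reindex (splitEquiv a b).symm

theorem isChannel_traceFst : IsChannel fun ρ : QMat (a + b) => traceFst (a := a) ρ := by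
  convert IsChannel.sum_submatrix (fun (z : Bits a) (s : Bits b) => Fin.append z s)
    bijective_append using 1
  funext ρ s t
  simp [traceFst, Matrix.sum_apply]

theorem ketbra_apply (x p q : Bits k) : ketbra x p q = if x = p ∧ x = q then 1 else 0 := by
  simp [ketbra, Matrix.single_apply]

theorem trace_tensor (ρ : QMat a) (σ : QMat b) :
    (tensor ρ σ).trace = ρ.trace * σ.trace := by
  simp only [Matrix.trace, Matrix.diag]
  rw [← (splitEquiv a b).symm.sum_comp, Fintype.sum_prod_type, Finset.sum_mul_sum]
  simp [tensor, splitEquiv]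

theorem trace_ketbra (x : Bits k) : (ketbra x).trace = 1 := by
  simp [ketbra]

/-- Complete positivity holds because adjoining a basis state means pulling `ρ` back along the
projection to the first `a` bits and masking. -/
theorem isChannel_tensor_ketbra (x : Bits b) : IsChannel fun ρ : QMat a => tensor ρ (ketbra x) := by
  refine ⟨?_, fun ρ => by rw [trace_tensor, trace_ketbra, mul_one]⟩
  refine ((IsCP.mask fun s : Bits (a + b) => x = (splitBits a b s).2).comp
    (IsCP.submatrix fun s : Bits (a + b) => (splitBits a b s).1)).congr fun ρ s t => ?_
  simp only [tensor, ketbra_apply, splitBits, mul_ite, mul_one, mul_zero]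
  exact if_congr Iff.rfl rfl rfl

theorem isChannel_ketbra_tensor (x : Bits a) : IsChannel fun ρ : QMat b => tensor (ketbra x) ρ := by
  refine ⟨?_, fun ρ => by rw [trace_tensor, trace_ketbra, one_mul]⟩
  refine ((IsCP.mask fun s : Bits (a + b) => x = (splitBits a b s).1).comp
    (IsCP.submatrix fun s : Bits (a + b) => (splitBits a b s).2)).congr fun ρ s t => ?_
  simp only [tensor, ketbra_apply, splitBits, ite_mul, one_mul, zero_mul]
  exact if_congr Iff.rfl rfl rfl

/-- A bitstring of length `w`, composed of its first `u` bits and the others. -/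
def glue {w : ℕ} (u : ℕ) (z : {i : Fin w // u ≤ i.1} → Bool) (s : Bits u) : Bits w :=
  fun i => if h : i.1 < u then s ⟨i.1, h⟩ else z ⟨i, not_lt.1 h⟩

theorem bijective_glue {u : ℕ} (hu : u ≤ w) :
    Function.Bijective fun x : ({i : Fin w // u ≤ i.1} → Bool) × Bits u => glue u x.1 x.2 := by
  constructor
  · rintro ⟨z, s⟩ ⟨z', s'⟩ h
    simp only [Prod.mk.injEq]
    constructor
    · funext i
      have := congrFun h i.1
      simpa [glue, not_lt.2 i.2] using this
    · funext i
      have := congrFun h (Fin.castLE hu i)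
      simpa [glue] using this
  · intro y
    refine ⟨(fun i => y i.1, fun i => y (Fin.castLE hu i)), ?_⟩
    funext i
    by_cases h : i.1 < u <;> simp [glue, h]

theorem keepFirst_eq_sum {u : ℕ} (ρ : QMat w) :
    keepFirst u ρ = ∑ z, ρ.submatrix (glue u z) (glue u z) := by
  ext s t
  simp only [keepFirst, Matrix.sum_apply, Matrix.submatrix_apply]
  rfl

theorem isChannel_keepFirst {u : ℕ} (hu : u ≤ w) :
    IsChannel fun ρ : QMat w => keepFirst u ρ := by
  simp only [keepFirst_eq_sum]
  exact IsChannel.sum_submatrix _ (bijective_glue hu)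

/-! ### Gates -/

theorem extend_comp_wires (e : Fin k ↪ Fin w) (p : Bits k) (s : Bits w) :
    (fun i => Function.extend e p s (e i)) = p :=
  funext fun i => e.injective.extend_apply p s i

theorem extend_extend (e : Fin k ↪ Fin w) (p q : Bits k) (s : Bits w) :
    Function.extend e p (Function.extend e q s) = Function.extend e p s := by
  funext i
  by_cases h : ∃ j, e j = i
  · obtain ⟨j, rfl⟩ := h
    rw [e.injective.extend_apply, e.injective.extend_apply]
  · rw [Function.extend_apply' _ _ _ h, Function.extend_apply' _ _ _ h,
      Function.extend_apply' _ _ _ h]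

theorem extend_self_wires (e : Fin k ↪ Fin w) (s : Bits w) :
    Function.extend e (fun i => s (e i)) s = s := by
  funext i
  by_cases h : ∃ j, e j = i
  · obtain ⟨j, rfl⟩ := h
    rw [e.injective.extend_apply]
  · rw [Function.extend_apply' _ _ _ h]

/-- Replacing some bits by all possible bits reaches every bitstring equally often. -/
theorem sum_extend {M : Type} [AddCommMonoid M] (e : Fin k ↪ Fin w) (F : Bits w → M) :
    ∑ s : Bits w, ∑ p : Bits k, F (Function.extend e p s) = 2 ^ k • ∑ s, F s := by
  -- Exchanging the bits of `s` on the wires with the separate bits `p` is an involution, so the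
  -- double sum can be reindexed by it.
  have : Function.Involutive fun x : Bits w × Bits k =>
      ((Function.extend e x.2 x.1, fun i => x.1 (e i)) : Bits w × Bits k) := by
    rintro ⟨s, p⟩
    simp only [extend_comp_wires, extend_extend, extend_self_wires]
  rw [← Fintype.sum_prod_type' fun s p => F (Function.extend e p s),
    this.bijective.sum_comp fun x => F x.1, Fintype.sum_prod_type]
  simp [← Finset.smul_sum]

/-- The trace of a matrix whose diagonal is read off local matrices. -/
theorem sum_local (e : Fin k ↪ Fin w) (B : Bits w → QMat k)
    (hB : ∀ p s, B (Function.extend e p s) = B s) :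
    2 ^ k • ∑ s, B s (fun i => s (e i)) (fun i => s (e i)) = ∑ s, (B s).trace := by
  rw [← sum_extend e fun s => B s (fun i => s (e i)) (fun i => s (e i))]
  refine Finset.sum_congr rfl fun s _ => Finset.sum_congr rfl fun p _ => ?_
  rw [hB, extend_comp_wires]
  rfl

theorem smul_two_pow_cancel {n : ℕ} {x y : ℂ} (h : 2 ^ n • x = 2 ^ n • y) : x = y := by
  simpa using h

/-- Instead of splitting the register, `ρ` is pulled back to the redundant index set `Bits k × Bits
w`; submatrices along non-injective maps stay positive. Each string outside the wires is then
counted `2 ^ k` times, so the trace identity is proved after multiplication by `2 ^ k`. -/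
theorem isChannel_applyUnitary {U : QMat k} (hU : Uᴴ * U = 1) (e : Fin k ↪ Fin w) :
    IsChannel fun ρ : QMat w => applyUnitary U e ρ := by
  refine ⟨?_, fun ρ => smul_two_pow_cancel (n := k) ?_⟩
  · exact (IsCP.submatrix fun s : Bits w => (((fun i => s (e i)), s) : Bits k × Bits w)).comp <|
      ((IsCP.conj U).ampl (γ := Bits w)).comp <|
      IsCP.submatrix fun x : Bits k × Bits w => Function.extend e x.1 x.2
  · refine (sum_local e (fun s => U * (Matrix.of fun p q : Bits k =>
      ρ (Function.extend e p s) (Function.extend e q s)) * Uᴴ) fun p s => ?_).trans ?_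
    · simp only [extend_extend]
    · refine Eq.trans ?_ (sum_extend e fun s => ρ s s)
      refine Finset.sum_congr rfl fun s _ => ?_
      rw [Matrix.trace_mul_cycle, hU, Matrix.one_mul]
      rfl

theorem isChannel_applyReset (i : Fin w) : IsChannel fun ρ : QMat w => applyReset i ρ := by
  refine ⟨?_, fun ρ => ?_⟩
  · refine ((IsCP.mask fun s : Bits w => s i = false).comp (IsCP.sum Finset.univ fun b _ =>
      IsCP.submatrix fun s : Bits w => Function.update s i b)).congr fun ρ s t => ?_
    simp [applyReset, Matrix.sum_apply]
  -- As in `sum_extend`: exchange bit `i` with the separate bit.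
  · have : Function.Involutive fun x : Bits w × Bool =>
        ((Function.update x.1 i x.2, x.1 i) : Bits w × Bool) := by
      rintro ⟨s, b⟩
      simp
    simp only [Matrix.trace, Matrix.diag, applyReset, and_self]
    calc _ = ∑ s : Bits w, ∑ b : Bool, if s i = false then
            ρ (Function.update s i b) (Function.update s i b) else 0 :=
          Finset.sum_congr rfl fun s _ => by split_ifs <;> simp
      _ = ∑ x : Bits w × Bool, if x.2 = false then ρ x.1 x.1 else 0 := by
          rw [← Fintype.sum_prod_type' fun (s : Bits w) (b : Bool) => if s i = false then
            ρ (Function.update s i b) (Function.update s i b) else 0, ← this.bijective.sum_comp]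
          simp
      _ = _ := by simp [Fintype.sum_prod_type]

theorem isChannel_dephase (i : Fin w) :
    IsChannel fun ρ : QMat w => ∑ b, applyProj i b ρ := by
  refine ⟨.sum _ fun b _ => .mask fun s : Bits w => s i = b, fun ρ => ?_⟩
  rw [Matrix.trace_sum]
  simp only [Matrix.trace, Matrix.diag]
  rw [Finset.sum_comm]
  refine Finset.sum_congr rfl fun s _ => ?_
  simp [applyProj]

theorem extend_comm {b : ℕ} (e : Fin a ↪ Fin w) (e' : Fin b ↪ Fin w) (he : ∀ i j, e i ≠ e' j)
    (p : Bits a) (q : Bits b) (s : Bits w) :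
    Function.extend e p (Function.extend e' q s) = Function.extend e' q (Function.extend e p s) := by
  funext i
  by_cases h : ∃ j, e j = i
  · obtain ⟨j, rfl⟩ := h
    rw [e.injective.extend_apply, Function.extend_apply' _ _ _ (fun ⟨l, hl⟩ => he j l hl.symm),
      e.injective.extend_apply]
  · rw [Function.extend_apply' _ _ _ h]
    by_cases h' : ∃ j, e' j = i
    · obtain ⟨j, rfl⟩ := h'
      rw [e'.injective.extend_apply, e'.injective.extend_apply]
    · rw [Function.extend_apply' _ _ _ h', Function.extend_apply' _ _ _ h',
        Function.extend_apply' _ _ _ h]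

/-- The block `h s` given to `Φ` does not depend on the bits of `s` on `ins` or `outs`. Averaging
over the bits on `outs` turns entries of `Φ (h s)` into its trace, which is that of `h s`.
Disjointness of the wires lets the two replacements commute. -/
theorem isChannel_applyCall {Φ : QMat a → QMat b} (hΦ : IsChannel Φ) (ins : Fin a ↪ Fin w)
    (outs : Fin b ↪ Fin w) (disj : ∀ i j, ins i ≠ outs j) :
    IsChannel fun ρ : QMat w => applyCall Φ ins outs ρ := by
  refine ⟨?_, fun ρ => smul_two_pow_cancel (n := b) (smul_two_pow_cancel (n := a) ?_)⟩
  · refine IsCP.congr ((IsCP.mask fun s : Bits w => ∀ i, s (ins i) = false).comp <|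
      (IsCP.submatrix fun s : Bits w => (((fun i => s (outs i)), s) : Bits b × Bits w)).comp <|
      (hΦ.toIsCP.ampl (γ := Bits w)).comp <|
      IsCP.sum Finset.univ fun (z : Bits b) _ =>
        IsCP.submatrix fun x : Bits a × Bits w =>
          Function.extend ins x.1 (Function.extend outs z x.2)) fun ρ s t => ?_
    simp only [applyCall, Matrix.submatrix_apply, QEnc.ampl, Matrix.sum_apply]
  · set h : Bits w → QMat a := fun s p q => ∑ z : Bits b,
      ρ (Function.extend ins p (Function.extend outs z s))
        (Function.extend ins q (Function.extend outs z s)) with h_def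
    have hh (p s) : h (Function.extend ins p s) = h s := by
      funext q q'
      simp only [h_def, ← extend_comm ins outs disj, extend_extend]
    calc _ = 2 ^ a • (2 ^ b • ∑ s : Bits w, (if ∀ i, s (ins i) = false then Φ (h s) else 0 : QMat b)
            (fun j => s (outs j)) (fun j => s (outs j))) := by
          congr 2
          refine Finset.sum_congr rfl fun s _ => ?_
          simp only [Matrix.diag, applyCall, and_self, h_def]
          split_ifs <;> rfl
      _ = 2 ^ a • ∑ s : Bits w, if ∀ i, s (ins i) = false then (h s).trace else 0 := by
          rw [sum_local outs fun s => (if ∀ i, s (ins i) = false then Φ (h s) else 0 : QMat b)]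
          · congr 1
            refine Finset.sum_congr rfl fun s _ => ?_
            split_ifs
            · exact hΦ.trace_eq _
            · simp
          · intro p s
            have hi (i : Fin a) : Function.extend outs p s (ins i) = s (ins i) :=
              Function.extend_apply' _ _ _ fun ⟨j, hj⟩ => disj i j hj.symm
            simp only [hi, h_def, extend_extend]
      -- Of the `2 ^ a` settings of the input wires exactly one, all zeros, survives, which cancels
      -- the factor `2 ^ a`.
      _ = ∑ s : Bits w, (h s).trace := by
          rw [← sum_extend ins]
          refine Finset.sum_congr rfl fun s _ => ?_
          simp only [hh, ins.injective.extend_apply]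
          rw [Fintype.sum_eq_single fun _ => false]
          · simp
          · intro p hp
            exact if_neg fun h => hp (funext h)
      _ = ∑ s : Bits w, ∑ z : Bits b, ∑ p : Bits a,
            ρ (Function.extend ins p (Function.extend outs z s))
              (Function.extend ins p (Function.extend outs z s)) := by
          refine Finset.sum_congr rfl fun s _ => ?_
          rw [Finset.sum_comm]
          rfl
      _ = 2 ^ a • (2 ^ b • ρ.trace) := by
          rw [sum_extend outs fun s => ∑ p : Bits a,
              ρ (Function.extend ins p s) (Function.extend ins p s),
            sum_extend ins fun s => ρ s s, smul_comm]
          rfl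

end Registers

end QEnc

namespace QEnc

open scoped Matrix

/-! ### The channel of a circuit -/

section CircuitChannel

theorem permMatrix_unitary {k : ℕ} {f : Bits k → Bits k} (hf : Function.Injective f) :
    (permMatrix f)ᴴ * permMatrix f = 1 := by
  ext p q
  simp [Matrix.mul_apply, Matrix.conjTranspose_apply, permMatrix, Matrix.one_apply, hf.eq_iff,
    eq_comm]

theorem forall_bits_one {P : Bits 1 → Prop} : (∀ p, P p) ↔ P ![false] ∧ P ![true] := by
  refine ⟨fun h => ⟨h _, h _⟩, fun h p => ?_⟩
  have : p = ![p 0] := by ext i; fin_cases i; rfl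
  rw [this]
  cases p 0
  exacts [h.1, h.2]

theorem sum_bits_one (F : Bits 1 → ℂ) : ∑ p, F p = F ![false] + F ![true] := by
  rw [← (Equiv.funUnique (Fin 1) Bool).symm.sum_comp, Fintype.sum_bool, add_comm]
  congr 2 <;> ext i <;> fin_cases i <;> rfl

theorem unitary_bits_one {U : QMat 1}
    (h₁ : star (U ![false] ![false]) * U ![false] ![false] +
      star (U ![true] ![false]) * U ![true] ![false] = 1)
    (h₂ : star (U ![false] ![false]) * U ![false] ![true] +
      star (U ![true] ![false]) * U ![true] ![true] = 0)
    (h₃ : star (U ![false] ![true]) * U ![false] ![false] +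
      star (U ![true] ![true]) * U ![true] ![false] = 0)
    (h₄ : star (U ![false] ![true]) * U ![false] ![true] +
      star (U ![true] ![true]) * U ![true] ![true] = 1) : Uᴴ * U = 1 := by
  refine Matrix.ext ?_
  simp only [forall_bits_one, Matrix.mul_apply, Matrix.conjTranspose_apply, sum_bits_one, h₁, h₂,
    h₃, h₄, Matrix.one_apply]
  simp

theorem UGate.matrix_unitary (g : UGate) : g.matrixᴴ * g.matrix = 1 := by
  cases g with
  | X => exact permMatrix_unitary (k := 1) (by decide)
  | CNOT => exact permMatrix_unitary (k := 2) (by decide)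
  | CCX => exact permMatrix_unitary (k := 3) (by decide)
  | H =>
    have h2 : ((Real.sqrt 2 : ℂ)⁻¹ * (Real.sqrt 2 : ℂ)⁻¹) = 1 / 2 := by
      rw [← mul_inv, ← Complex.ofReal_mul, Real.mul_self_sqrt (by norm_num)]
      norm_num
    apply unitary_bits_one <;> simp [UGate.matrix, h2] <;> norm_num
  | T =>
    have h1 : star (Complex.exp (Complex.I * Real.pi / 4)) * Complex.exp (Complex.I * Real.pi / 4) = 1 := by
      rw [Complex.star_def, ← Complex.exp_conj, ← Complex.exp_add]
      rw [map_div₀, map_mul, Complex.conj_I, Complex.conj_ofReal, map_ofNat, ← add_div]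
      simp
    apply unitary_bits_one <;> simp [UGate.matrix]
    exact h1

variable {I : Interface} {w : ℕ}

theorem sum_bits_succ {M : Type} [AddCommMonoid M] {n : ℕ} (F : Bits (n + 1) → M) :
    ∑ x, F x = ∑ b : Bool, ∑ x : Bits n, F (Fin.cons b x) := by
  rw [← (Fin.consEquiv fun _ => Bool).sum_comp, Fintype.sum_prod_type]
  rfl

/-- A single measurement branch loses trace; only the sum over all results is a channel. For a
measurement gate, the sum over its result is dephasing of the wire. -/
theorem isChannel_runGates {Φ : I.Impl} (hΦ : ∀ o, IsChannel (Φ o)) (gs : List (Gate I w)) :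
    IsChannel fun ρ : QMat w => ∑ x : Bits (measCount gs), runGates Φ gs (List.ofFn x) ρ := by
  induction gs with
  | nil =>
    convert (IsChannel.id : IsChannel fun ρ : QMat w => ρ) using 2 with ρ
    exact Fintype.sum_unique (ι := Bits 0) _
  | cons g gs ih =>
    cases g with
    | unitary g a => exact ih.comp (isChannel_applyUnitary g.matrix_unitary a)
    | reset i => exact ih.comp (isChannel_applyReset i)
    | call o ho ins outs disj => exact ih.comp (isChannel_applyCall (hΦ o) ins outs disj)
    | measure i =>
      convert ih.comp (isChannel_dephase i) using 2 with ρ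
      rw [ih.toIsCP.map_sum]
      refine (sum_bits_succ (n := measCount gs) fun x =>
        runGates Φ (.measure i :: gs) (List.ofFn x) ρ).trans ?_
      simp only [List.ofFn_cons, runGates]

theorem Circuit.isChannel_channel {k u : ℕ} (C : Circuit I k u) {Φ : I.Impl}
    (hΦ : ∀ o, IsChannel (Φ o)) : IsChannel fun ρ => C.channel Φ ρ := by
  have h := (isChannel_keepFirst C.out_le).comp <|
    (isChannel_runGates hΦ C.gates).comp (isChannel_tensor_ketbra (a := k) fun _ : Fin C.anc => false)
  convert h using 2 with ρ
  rw [(isChannel_keepFirst C.out_le).toIsCP.map_sum]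
  rfl

theorem isChannel_noImpl (o : Oracle) : IsChannel (noImpl o) :=
  IsChannel.id

theorem QPT.isChannel_map {k u : ℕ → ℕ} (A : QPT (fun _ => noOracle) k u) (n : ℕ) :
    IsChannel (A.map n) :=
  (A.circ n).isChannel_channel isChannel_noImpl

end CircuitChannel

/-! ### Gates without measurements -/

section SetGates

variable {I : Interface} {v : ℕ}

/-- The length condition makes `gs` consume all results, so `hs` starts with none; it is applied to
gates `hs` without measurements. -/
theorem runGates_append (Φ : I.Impl) (gs hs : List (Gate I v)) (x : List Bool)
    (hx : x.length = measCount gs) (ρ : QMat v) :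
    runGates Φ (gs ++ hs) x ρ = runGates Φ hs [] (runGates Φ gs x ρ) := by
  induction gs generalizing x ρ with
  | nil =>
    obtain rfl := List.length_eq_zero_iff.1 hx
    rfl
  | cons g gs ih =>
    cases g with
    | measure i =>
      cases x with
      | nil => simp [measCount] at hx
      | cons b x => exact ih x (by simpa [measCount] using hx) _
    | unitary g a => exact ih x hx _
    | reset i => exact ih x hx _
    | call o ho ins outs disj => exact ih x hx _

theorem measCount_append (gs hs : List (Gate I v)) :
    measCount (gs ++ hs) = measCount gs + measCount hs := by
  induction gs with
  | nil => simp [measCount]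
  | cons g gs ih => cases g <;> simp [measCount, ih]; omega

theorem countP_isMeas_natSyms (n : ℕ) : (natSyms n).countP isMeas = 0 := by
  simp [natSyms, List.countP_replicate, isMeas]

theorem countP_isMeas_wireSyms {r w : ℕ} (a : Fin r → Fin w) :
    (wireSyms a).countP isMeas = 0 := by
  simp [wireSyms, List.countP_flatMap, Function.comp_def, countP_isMeas_natSyms]

/-- The symbol `measure` occurs in a description only as the name of a measurement gate, so counting
symbols counts gates. -/
theorem countP_isMeas_syms (gs : List (Gate I v)) :
    (gs.flatMap Gate.syms).countP isMeas = measCount gs := by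
  induction gs with
  | nil => rfl
  | cons g gs ih =>
    rw [List.flatMap_cons, List.countP_append, ih]
    cases g with
    | measure i => 
      rw [Gate.syms, List.countP_cons, countP_isMeas_natSyms, measCount,
        if_pos (show isMeas .measure = true from rfl)]
      omega
    | unitary g a => cases g <;>
        simp [Gate.syms, isMeas, UGate.sym, countP_isMeas_wireSyms, measCount]
    | reset i => simp [Gate.syms, isMeas, countP_isMeas_natSyms, measCount]
    | call o ho ins outs disj => cases o <;>
        simp [Gate.syms, isMeas, Oracle.sym, countP_isMeas_wireSyms, measCount]

/-- Gates which put the wire `i` into the state `|b⟩`. -/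
def setGate (i : Fin v) (b : Bool) : List (Gate I v) :=
  .reset i :: if b then
    [.unitary .X ⟨fun _ => i, fun p q _ => Subsingleton.elim (α := Fin 1) p q⟩] else []

/-- Gates which put the wires from `j` on into the basis state given by a list of bits. -/
def setGates : ∀ (j : ℕ) (l : List Bool), j + l.length ≤ v → List (Gate I v)
  | _, [], _ => []
  | j, b :: l, h => setGates (j + 1) l (by simp at h; omega) ++
      setGate ⟨j, by simp at h; omega⟩ b

theorem measCount_setGate (i : Fin v) (b : Bool) : measCount (setGate (I := I) i b) = 0 := by
  cases b <;> rfl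

theorem measCount_setGates (j : ℕ) (l : List Bool) (h : j + l.length ≤ v) :
    measCount (setGates (I := I) j l h) = 0 := by
  induction l generalizing j with
  | nil => rfl
  | cons b l ih => rw [setGates, measCount_append, ih, measCount_setGate]

theorem syms_setGates (j : ℕ) (l : List Bool) (h : j + l.length ≤ v) :
    (setGates (I := I) j l h).flatMap Gate.syms = setSyms j l := by
  induction l generalizing j with
  | nil => rfl
  | cons b l ih =>
    rw [setGates, List.flatMap_append, ih, setSyms]
    cases b
    · simp [setGate, Gate.syms]
    · simp [setGate, Gate.syms, wireSyms, UGate.sym, UGate.arity]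
      rfl

theorem applyUnitary_permMatrix {k : ℕ} {f : Bits k → Bits k} (hf : Function.Involutive f)
    (e : Fin k ↪ Fin v) (ρ : QMat v) (s t : Bits v) :
    applyUnitary (permMatrix f) e ρ s t =
      ρ (Function.extend e (f fun i => s (e i)) s) (Function.extend e (f fun i => t (e i)) t) := by
  have (p q : Bits k) : p = f q ↔ q = f p := ⟨fun h => by rw [h, hf], fun h => by rw [h, hf]⟩
  simp [applyUnitary, Matrix.mul_apply, permMatrix, this, apply_ite (starRingEnd ℂ)]

theorem applyUnitary_X (i : Fin v) (e : Fin 1 ↪ Fin v) (he : e 0 = i) (ρ : QMat v) (s t : Bits v) :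
    applyUnitary UGate.X.matrix e ρ s t =
      ρ (Function.update s i (!s i)) (Function.update t i (!t i)) := by
  have h (s : Bits v) : Function.extend e ![!s (e 0)] s = Function.update s i (!s i) := by
    subst he
    funext j
    by_cases hj : j = e 0
    · subst hj
      simp [e.injective.extend_apply]
    · rw [Function.extend_apply' _ _ _ fun ⟨l, hl⟩ => hj (by rw [← hl, Subsingleton.elim l 0]),
        Function.update_of_ne hj]
  rw [← h, ← h]
  exact applyUnitary_permMatrix (k := 1) (fun p => by simp [funext_iff]) e ρ s t

theorem runGates_setGate (Φ : I.Impl) (i : Fin v) (b : Bool) (ρ : QMat v) (s t : Bits v) :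
    runGates Φ (setGate i b) [] ρ s t =
      if s i = b ∧ t i = b then ∑ c, ρ (Function.update s i c) (Function.update t i c) else 0 := by
  cases b with
  | false => rfl
  | true =>
    simp only [setGate, if_true, runGates]
    refine (applyUnitary_X i _ rfl _ s t).trans ?_
    simp [applyReset]

/-- The bitstring `s` with the bits from `j` on replaced by `z`. -/
def overwrite {n : ℕ} (j : ℕ) (z : Bits n) (s : Bits v) : Bits v := fun i =>
  if h : j ≤ i.1 ∧ i.1 < j + n then z ⟨i.1 - j, by omega⟩ else s i

theorem overwrite_cons {n : ℕ} (j : ℕ) (hj : j < v) (b : Bool) (z : Bits n) (s : Bits v) :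
    overwrite (n := n + 1) j (Fin.cons b z) s = overwrite (j + 1) z (Function.update s ⟨j, hj⟩ b) := by
  funext i
  rcases lt_trichotomy i.1 j with h | h | h
  · rw [overwrite, overwrite, dif_neg (by omega), dif_neg (by omega),
      Function.update_of_ne (Fin.ne_of_val_ne h.ne)]
  · obtain rfl : i = ⟨j, hj⟩ := Fin.ext h
    rw [overwrite, overwrite, dif_pos (by simp), dif_neg (by simp)]
    simp [Fin.cons_zero]
  · rw [overwrite, overwrite]
    by_cases h' : i.1 < j + 1 + n
    · rw [dif_pos (by omega), dif_pos (by omega)]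
      have : (⟨i.1 - j, by omega⟩ : Fin (n + 1)) = Fin.succ ⟨i.1 - (j + 1), by omega⟩ := by
        ext
        simp
        omega
      rw [this, Fin.cons_succ]
    · rw [dif_neg (by omega), dif_neg (by omega), Function.update_of_ne (Fin.ne_of_val_ne h.ne')]

/-- The bits from `j` on are those of `l`. -/
def Agrees (j : ℕ) (l : List Bool) (s : Bits v) : Prop :=
  ∀ (i : ℕ) (hi : j + i < v) (h : i < l.length), s ⟨j + i, hi⟩ = l[i]

theorem agrees_cons (j : ℕ) (hj : j < v) (b : Bool) (l : List Bool) (s : Bits v) :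
    Agrees j (b :: l) s ↔ s ⟨j, hj⟩ = b ∧ Agrees (j + 1) l s := by
  refine ⟨fun h => ⟨h 0 hj (by simp), fun i hi h' => ?_⟩, fun h i hi h' => ?_⟩
  · have := h (i + 1) (by omega) (by simpa using h')
    simpa [add_assoc, add_comm 1 i] using this
  · cases i with
    | zero => exact h.1
    | succ i =>
      have := h.2 i (by omega) (by simpa using h')
      simpa [add_assoc, add_comm 1 i] using this

theorem agrees_update (j : ℕ) (hj : j < v) (b : Bool) (l : List Bool) (s : Bits v) :
    Agrees (j + 1) l (Function.update s ⟨j, hj⟩ b) ↔ Agrees (j + 1) l s := by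
  refine forall_congr' fun i => forall_congr' fun hi => ?_
  rw [Function.update_of_ne (Fin.ne_of_val_ne (by simp; omega))]

-- Setting wires one by one traces out each old bit and requires the new one; the sums over single
-- bits combine, via `overwrite_cons`, into a sum over strings.
open scoped Classical in
theorem runGates_setGates (Φ : I.Impl) (j : ℕ) (l : List Bool) (h : j + l.length ≤ v)
    (ρ : QMat v) (s t : Bits v) :
    runGates Φ (setGates j l h) [] ρ s t =
      if Agrees j l s ∧ Agrees j l t then
        ∑ z : Bits l.length, ρ (overwrite j z s) (overwrite j z t)
      else 0 := by
  induction l generalizing j s t with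
  | nil =>
    have h0 (z : Bits 0) (s : Bits v) : overwrite j z s = s :=
      funext fun i => dif_neg (by omega)
    have h1 (s : Bits v) : Agrees j [] s := fun i hi h => absurd h (by simp)
    rw [if_pos ⟨h1 s, h1 t⟩]
    exact ((Fintype.sum_unique (ι := Bits 0) _).trans (by rw [h0, h0]; rfl)).symm
  | cons b l ih =>
    have hj : j < v := by simp at h; omega
    rw [setGates, runGates_append _ _ _ _ (by rw [measCount_setGates]; rfl), runGates_setGate]
    simp only [ih, agrees_cons j hj, agrees_update]
    have hs : ∑ z : Bits (b :: l).length, ρ (overwrite j z s) (overwrite j z t) =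
        ∑ c, ∑ z : Bits l.length, ρ (overwrite (j + 1) z (Function.update s ⟨j, hj⟩ c))
          (overwrite (j + 1) z (Function.update t ⟨j, hj⟩ c)) :=
      (sum_bits_succ (n := l.length) _).trans (by simp only [overwrite_cons j hj])
    rw [hs]
    by_cases h₁ : s ⟨j, hj⟩ = b ∧ t ⟨j, hj⟩ = b
    · by_cases h₂ : Agrees (j + 1) l s ∧ Agrees (j + 1) l t
      · rw [if_pos h₁, if_pos ⟨⟨h₁.1, h₂.1⟩, h₁.2, h₂.2⟩]
        simp only [if_pos h₂]
      · rw [if_pos h₁, if_neg fun h => h₂ ⟨h.1.2, h.2.2⟩]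
        simp only [if_neg h₂, Finset.sum_const_zero]
    · rw [if_neg h₁, if_neg fun h => h₁ ⟨h.1.1, h.2.1⟩]

end SetGates

end QEnc

namespace QEnc

variable {I : Interface} {k u m e : ℕ}

/-! ### Circuits that write basis states -/

theorem overwrite_glue {v n : ℕ} (y : Bits n) (z : {i : Fin v // n + e ≤ i.1} → Bool)
    (s : Bits (n + e)) :
    overwrite 0 y (glue (n + e) z s) =
      glue (n + e) z (Fin.append y fun j => s (Fin.natAdd n j)) := by
  funext i
  by_cases h : i.1 < n
  · rw [overwrite, dif_pos (by omega), glue, dif_pos (by omega)]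
    exact (Fin.append_left y _ ⟨i.1, h⟩).symm
  · rw [overwrite, dif_neg (by omega), glue, glue]
    split_ifs with h'
    · have := Fin.append_right y (fun j => s (Fin.natAdd n j)) ⟨i.1 - n, by omega⟩
      have hi : Fin.natAdd n (⟨i.1 - n, by omega⟩ : Fin e) = ⟨i.1, h'⟩ := by ext; simp; omega
      rw [hi] at this
      exact this.symm
    · rfl

theorem agrees_glue {v : ℕ} (l : List Bool) (hv : l.length + e ≤ v)
    (z : {i : Fin v // l.length + e ≤ i.1} → Bool) (s : Bits (l.length + e)) :
    Agrees 0 l (glue (l.length + e) z s) ↔ (fun i => l[i.1]) = fun i => s (Fin.castAdd e i) := by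
  rw [funext_iff]
  refine ⟨fun h i => ?_, fun h i hi h' => ?_⟩
  · have := h i.1 (by omega) i.2
    rw [← this, glue, dif_pos (by simp; omega)]
    congr 1
    ext
    simp
  · rw [glue, dif_pos (by simp; omega), h ⟨i, h'⟩]
    congr 1
    ext
    simp

/-- Both sides sum over the old contents of the first `m` wires and over the discarded wires, only
in different orders. -/
theorem keepFirst_runGates_setGates {v : ℕ} (Φ : I.Impl) (l : List Bool) (hl : l.length = m)
    (h : 0 + l.length ≤ v) (hv : m + e ≤ v) (ρ : QMat v) :
    keepFirst (m + e) (runGates Φ (setGates 0 l h) [] ρ) =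
      tensor (ketbra fun i => l[i.1]) (traceFst (a := m) (keepFirst (m + e) ρ)) := by
  classical
  subst hl
  ext s t
  simp only [keepFirst_eq_sum, Matrix.sum_apply, Matrix.submatrix_apply, runGates_setGates,
    agrees_glue _ hv, overwrite_glue, tensor, ketbra_apply, traceFst, ite_mul, one_mul, zero_mul]
  split_ifs with h
  · exact Finset.sum_comm
  · simp

theorem runGates_setGates_all {v : ℕ} (Φ : I.Impl) (l : List Bool) (hl : l.length = v)
    (h : 0 + l.length ≤ v) (ρ : QMat v) :
    runGates Φ (setGates 0 l h) [] ρ = ρ.trace • ketbra fun i : Fin v => l[i.1] := by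
  classical
  subst hl
  have h₁ (z s : Bits l.length) : overwrite 0 z s = z := by
    funext i
    simp [overwrite]
  have h₂ (s : Bits l.length) : Agrees 0 l s ↔ (fun i => l[i.1]) = s := by
    rw [funext_iff]
    refine ⟨fun h i => ?_, fun h i hi h' => ?_⟩
    · simpa using (h i.1 (by omega) i.2).symm
    · simpa using (h ⟨i, h'⟩).symm
  ext s t
  simp only [runGates_setGates, h₁, h₂, Matrix.smul_apply, ketbra_apply, smul_eq_mul, mul_ite,
    mul_one, mul_zero]
  rfl

theorem keepFirst_self {v : ℕ} (ρ : QMat v) : keepFirst v ρ = ρ := by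
  ext s t
  have : IsEmpty {i : Fin v // v ≤ i.1} := ⟨fun i => absurd i.2 (not_le.2 i.1.2)⟩
  simp [keepFirst]

/-- Summands that see only the list of bits avoid transport along `a = b`. -/
theorem sum_bits_congr {M : Type} [AddCommMonoid M] {a b : ℕ} (h : a = b) (F : List Bool → M) :
    ∑ x : Bits a, F (List.ofFn x) = ∑ x : Bits b, F (List.ofFn x) := by
  subst h
  rfl

/-- The circuit which resets the first `m` output wires at the end. -/
def Circuit.resetFst (C : Circuit I k (m + e)) : Circuit I k (m + e) where
  anc := C.anc
  gates := C.gates ++ setGates 0 (List.replicate m false)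
    (by have := C.out_le; simp; omega)
  out_le := C.out_le

theorem Circuit.numMeas_resetFst (C : Circuit I k (m + e)) : C.resetFst.numMeas = C.numMeas := by
  simp [Circuit.numMeas, Circuit.resetFst, measCount_append, measCount_setGates]

theorem Circuit.syms_resetFst (C : Circuit I k (m + e)) :
    C.resetFst.syms = C.syms ++ setSyms 0 (List.replicate m false) := by
  simp [Circuit.syms, Circuit.resetFst, syms_setGates]

/-- The identity holds for each string of measurement results, not just on average; this is needed
because `f` is applied to that string. -/
theorem Circuit.run_resetFst (C : Circuit I k (m + e)) (Φ : I.Impl) (x : Bits C.resetFst.numMeas)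
    (ρ : QMat k) :
    C.resetFst.run Φ x ρ = tensor (zeroState m) (traceFst
      (C.run Φ (fun i => x (Fin.cast C.numMeas_resetFst.symm i)) ρ)) := by
  have hx : List.ofFn (fun i => x (Fin.cast C.numMeas_resetFst.symm i)) = List.ofFn x :=
    (List.ofFn_congr C.numMeas_resetFst x).symm
  rw [Circuit.run, Circuit.run, hx]
  refine (congrArg (keepFirst (m + e)) (runGates_append Φ C.gates _ _ ?_ _)).trans ?_
  · rw [List.length_ofFn]
    exact C.numMeas_resetFst
  · refine (keepFirst_runGates_setGates Φ _ (by simp) _ C.out_le _).trans ?_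
    simp [zeroState]
    rfl

theorem Circuit.sum_resetFst {M : Type} [AddCommMonoid M] (C : Circuit I k (m + e))
    (F : Bits C.numMeas → M) :
    ∑ x : Bits C.resetFst.numMeas, F (fun i => x (Fin.cast C.numMeas_resetFst.symm i)) =
      ∑ x, F x :=
  ((finCongr C.numMeas_resetFst).arrowCongr (Equiv.refl Bool)).sum_comp F

theorem traceFst_zeroState_tensor (σ : QMat e) :
    traceFst (tensor (zeroState m) σ) = σ := by
  ext s t
  simp only [traceFst, tensor, zeroState, ketbra_apply, Fin.append_left, Fin.append_right, ite_mul,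
    one_mul, zero_mul, and_self]
  exact (Finset.sum_ite_eq Finset.univ (fun _ => false : Bits m) _).trans
    (if_pos (Finset.mem_univ _))

theorem Circuit.channel_resetFst (C : Circuit I k (m + e)) (Φ : I.Impl) (ρ : QMat k) :
    C.resetFst.channel Φ ρ = tensor (zeroState m) (traceFst (C.channel Φ ρ)) := by
  have h : IsChannel fun ρ : QMat (m + e) => tensor (zeroState m) (traceFst ρ) :=
    (isChannel_ketbra_tensor _).comp isChannel_traceFst
  rw [Circuit.channel, Circuit.channel, h.toIsCP.map_sum, ← C.sum_resetFst]
  exact Finset.sum_congr rfl fun x _ => C.run_resetFst Φ x ρ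

/-- The circuit that discards its input and outputs a basis state. -/
def Circuit.write (I : Interface) (k anc : ℕ) (l : List Bool) (hl : l.length = k + anc) :
    Circuit I k (k + anc) where
  anc := anc
  gates := setGates 0 l (by omega)
  out_le := le_rfl

theorem Circuit.syms_write (anc : ℕ) (l : List Bool) (hl : l.length = k + anc) :
    (Circuit.write I k anc l hl).syms =
      natSyms k ++ natSyms anc ++ natSyms (k + anc) ++ setSyms 0 l := by
  simp [Circuit.syms, Circuit.write, syms_setGates]

theorem Circuit.channel_write (anc : ℕ) (l : List Bool) (hl : l.length = k + anc) (Φ : I.Impl)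
    (ρ : QMat k) :
    (Circuit.write I k anc l hl).channel Φ ρ = ρ.trace • ketbra fun i : Fin (k + anc) => l[i.1] := by
  refine (sum_bits_congr (b := 0) (measCount_setGates _ _ _) fun x =>
    keepFirst _ (runGates Φ (setGates 0 l _) x (tensor ρ (zeroState anc)))).trans ?_
  refine (Fintype.sum_unique (ι := Bits 0) _).trans ?_
  rw [keepFirst_self, List.ofFn_zero, runGates_setGates_all _ _ hl, trace_tensor, zeroState, trace_ketbra, mul_one]

/-! ### Constant Boolean circuits -/

/-- The Boolean circuit with `N` inputs that outputs a single `1`. -/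
def BoolCircuit.constTrue (N : ℕ) : BoolCircuit where
  inputs := N
  gates := [.const true]
  outputs := [N]
  gates_valid t ht := by
    obtain rfl : t = 0 := by simpa using ht
    trivial
  outputs_valid i hi := by simp at hi; simp [hi]

theorem BoolCircuit.eval_constTrue {N : ℕ} {x : List Bool} (hx : x.length = N) :
    (BoolCircuit.constTrue N).eval x = [true] := by
  subst hx
  simp [BoolCircuit.eval, BoolCircuit.constTrue, BoolGate.eval]

theorem BoolCircuit.bits_constTrue (N : ℕ) : (BoolCircuit.constTrue N).bits = constBits N := by
  simp [BoolCircuit.bits, BoolCircuit.constTrue, constBits, BoolGate.bits]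

theorem length_constBits (N : ℕ) : (constBits N).length = 2 * N + 8 := by
  simp [constBits, natBits]
  omega

end QEnc

namespace QEnc

open scoped ComplexOrder Matrix

/-! ### Outcome probabilities -/

section OutProb

variable {u : ℕ}

theorem outProb_sum {ι : Type} (s : Finset ι) (ρ : ι → QMat u) (y : List Bool) :
    outProb (∑ i ∈ s, ρ i) y = ∑ i ∈ s, outProb (ρ i) y := by
  simp only [outProb, Matrix.sum_apply, Complex.re_sum]
  rw [Finset.sum_comm]
  refine Finset.sum_congr rfl fun w _ => ?_
  split_ifs <;> simp

theorem outProb_nonneg {ρ : QMat u} (hρ : ρ.PosSemidef) (y : List Bool) : 0 ≤ outProb ρ y := by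
  refine Finset.sum_nonneg fun w _ => ?_
  split_ifs
  · exact (Complex.nonneg_iff.1 hρ.diag_nonneg).1
  · exact le_rfl

/-- Distinct strings are disjoint events: each diagonal entry is counted at most once. Equality can
fail, e.g. for strings of the wrong length. -/
theorem sum_outProb_le {ρ : QMat u} (hρ : ρ.PosSemidef) {ι : Type} (s : Finset ι)
    {y : ι → List Bool} (hy : Function.Injective y) : ∑ i ∈ s, outProb ρ (y i) ≤ ρ.trace.re := by
  simp only [outProb]
  rw [Finset.sum_comm, Matrix.trace, Complex.re_sum]
  refine Finset.sum_le_sum fun w _ => ?_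
  have hw : 0 ≤ (ρ w w).re := (Complex.nonneg_iff.1 hρ.diag_nonneg).1
  by_cases h : ∃ i ∈ s, List.ofFn w = y i
  · obtain ⟨i, hi, h⟩ := h
    rw [Finset.sum_eq_single_of_mem i hi fun j _ hj => if_neg fun h' => hj (hy (h'.symm.trans h)), if_pos h]
    rfl
  · rw [Finset.sum_eq_zero fun i hi => if_neg fun h' => h ⟨i, hi, h'⟩]
    exact hw

theorem posSemidef_ketbra (x : Bits u) : (ketbra x).PosSemidef := by
  have : ketbra x = Matrix.diagonal (Pi.single x (1 : ℂ)) := by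
    rw [ketbra, Matrix.diagonal_single]
  rw [this, Matrix.posSemidef_diagonal_iff]
  intro i
  by_cases h : i = x
  · subst h; simp
  · simp [h]

end OutProb

/-! ### The reduction, for an abstract game -/

namespace Game

/-- The games in which all parts are physically meaningful. -/
structure Valid (G : Game) : Prop where
  -- Any uniform family with `G.m n` outputs makes the message length readable from a printed
  -- description; decryption will serve.
  decUniform : ∃ (k : ℕ → ℕ), Nonempty (QPT (fun _ => noOracle) k G.m)
  prob_nonneg : ∀ n ek dk, 0 ≤ G.prob n ek dk
  sum_prob_le : ∀ n, ∑ ek, ∑ dk, G.prob n ek dk ≤ 1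
  enc : ∀ n ek, IsChannel (G.enc n ek)
  dec : ∀ n dk, IsChannel (G.dec n dk)

variable {G : Game} {att : Attack} {e u : ℕ → ℕ}

theorem Valid.isChannel_impl (hG : G.Valid) (S : Set Oracle) (n : ℕ) (ek : Bits (G.ekLen n))
    (dk : Bits n) : ∀ o, IsChannel (G.impl S n ek dk o)
  | .enc => hG.enc n ek
  | .dec => hG.dec n dk

/-- The message generator that replaces the message by `|0…0⟩`. -/
noncomputable def MessageGenerator.blank (M : G.MessageGenerator att e) {k : ℕ → ℕ}
    (D : QPT (fun _ => noOracle) k G.m) : G.MessageGenerator att e where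
  circ n := (M.circ n).resetFst
  uniform := by
    have h := PolyTime.appendResets (m := G.m) M.uniform D.uniform fun n => by
      simp only [Circuit.syms, List.append_assoc]
      rfl
    simpa only [Circuit.syms_resetFst] using h

/-- The algorithm that outputs the description of a constant Boolean circuit, with as many inputs as
the given message generator has measurement gates. -/
noncomputable def constFn (M : G.MessageGenerator att e) :
    QPT (G.iface att.oracles) G.inLen fun n => G.inLen n + (2 * (M.circ n).numMeas + 8) where
  circ n := Circuit.write _ (G.inLen n) (2 * (M.circ n).numMeas + 8)
    (constBits (M.circ n).numMeas ++ List.replicate (G.inLen n) false)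
    (by simp [length_constBits, add_comm])
  uniform := by
    have h := PolyTime.describeConst (k := G.inLen) M.uniform fun n => by
      simp only [Circuit.syms, List.append_assoc]
      rfl
    convert h using 2 with n
    simp only [Circuit.syms_write, constSyms, List.countP_append, countP_isMeas_natSyms,
      countP_isMeas_syms, zero_add]
    rfl

/-- The pair of a message generator and the constant function. -/
noncomputable def constPair (M : G.MessageGenerator att e) :
    G.GeneratorFunctionPair att e where
  gen := M
  len n := G.inLen n + (2 * (M.circ n).numMeas + 8)
  fn := constFn M
  circuit n _ := BoolCircuit.constTrue (M.circ n).numMeas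
  inputs_eq _ _ _ := rfl
  fn_spec n ek _ dk := by
    have hl : (constBits (M.circ n).numMeas ++ List.replicate (G.inLen n) false).length =
        G.inLen n + (2 * (M.circ n).numMeas + 8) := by
      simp [length_constBits, add_comm]
    -- The circuit overwrites and outputs its input wires too, which gives `G.inLen n` zeros of
    -- padding.
    refine ⟨fun i => (constBits (M.circ n).numMeas ++ List.replicate (G.inLen n) false)[i.1],
      ⟨G.inLen n, ?_⟩, (Circuit.channel_write _ _ hl _ _).trans ?_⟩
    · rw [BoolCircuit.bits_constTrue]
      exact List.ext_getElem (by simp [length_constBits, add_comm]) fun i _ _ => by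
        rw [List.getElem_ofFn]
    · rw [trace_ketbra, one_smul]

/-- The probability that `D` outputs `y` if the bit `b` is chosen. -/
noncomputable def answerProb (M : G.MessageGenerator att e) (D : G.Adversary att e u) (n : ℕ)
    (b : Bool) (y : List Bool) : ℝ :=
  G.keyAverage n fun ek dk =>
    outProb
      ((D.circ n).channel (G.impl att.oracles n ek dk)
        (onFst (G.enc n ek)
          (challenge
            ((M.circ n).channel (G.impl att.genOracles n ek dk) (ketbra (G.input n ek))) b)))
      y

theorem guessProb_eq (M : G.MessageGenerator att e) (D : G.Adversary att e u) (n : ℕ) :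
    guessProb M D n = (answerProb M D n true [true] + answerProb M D n false [false]) / 2 := by
  simp only [guessProb, answerProb, keyAverage, Fintype.sum_bool, ← Finset.sum_add_distrib,
    Finset.sum_div]
  refine Finset.sum_congr rfl fun ek _ => Finset.sum_congr rfl fun dk _ => ?_
  ring

/-- The answers `[true]` and `[false]` are disjoint outcomes of one state of trace one; the sum may
be smaller, as `D` may output other strings. -/
theorem Valid.answerProb_add_le (hG : G.Valid) (M : G.MessageGenerator att e)
    (D : G.Adversary att e u) (n : ℕ) :
    answerProb M D n false [true] + answerProb M D n false [false] ≤ 1 := by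
  rw [answerProb, answerProb, keyAverage, keyAverage]
  simp only [← Finset.sum_add_distrib, ← mul_add]
  refine le_trans (Finset.sum_le_sum fun ek _ => Finset.sum_le_sum fun dk _ =>
    mul_le_of_le_one_right (hG.prob_nonneg n ek dk) ?_) (hG.sum_prob_le n)
  set σ := (M.circ n).channel (G.impl att.genOracles n ek dk) (ketbra (G.input n ek)) with hσ
  have hM := (M.circ n).isChannel_channel (hG.isChannel_impl att.genOracles n ek dk)
  have hD := ((D.circ n).isChannel_channel (hG.isChannel_impl att.oracles n ek dk)).comp <|
    (isChannel_onFst (b := e n) (hG.enc n ek)).comp <|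
    (isChannel_ketbra_tensor (a := G.m n) (b := e n) fun _ => false).comp
      (isChannel_traceFst (a := G.m n))
  have hpos := hD.toIsCP.apply (hM.toIsCP.apply (posSemidef_ketbra (G.input n ek)))
  have htr := (hD.trace_eq _).trans ((hM.trace_eq (ketbra (G.input n ek))).trans (trace_ketbra _))
  have := sum_outProb_le hpos Finset.univ (y := fun b : Bool => [b])
    (fun a b h => by simpa using h)
  rw [htr, Fintype.sum_bool] at this
  exact this

theorem sum_outProb_run {I : Interface} {k m u : ℕ} (C : Circuit I k m) (Φ : I.Impl)
    {Ψ : QMat m → QMat u} (hΨ : IsCP Ψ) (ρ : QMat k) (y : List Bool) :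
    ∑ x, outProb (Ψ (C.run Φ x ρ)) y = outProb (Ψ (C.channel Φ ρ)) y := by
  rw [← outProb_sum, ← hΨ.map_sum]
  rfl

theorem Valid.isCP_attack (hG : G.Valid) (D : G.Adversary att e u) (n : ℕ)
    (ek : Bits (G.ekLen n)) (dk : Bits n) :
    IsCP fun ρ : QMat (G.m n + e n) =>
      (D.circ n).channel (G.impl att.oracles n ek dk) (onFst (G.enc n ek) ρ) :=
  (((D.circ n).isChannel_channel (hG.isChannel_impl att.oracles n ek dk)).comp
    (isChannel_onFst (hG.enc n ek))).toIsCP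

/-- For a constant function the target does not depend on `x`, so by additivity the sum over `x`
merges into the channel of the generator. -/
theorem Valid.realSuccess_constPair (hG : G.Valid) (M : G.MessageGenerator att e)
    (D : G.Adversary att e u) (n : ℕ) :
    realSuccess (constPair M) D n = answerProb M D n true [true] := by
  rw [realSuccess, answerProb]
  congr 1
  funext ek dk
  refine Eq.trans (Finset.sum_congr rfl fun x _ => congrArg _ ?_)
    (sum_outProb_run (M.circ n) (G.impl att.genOracles n ek dk) (hG.isCP_attack D n ek dk) _ _)
  exact BoolCircuit.eval_constTrue (List.length_ofFn)

theorem channel_blank (M : G.MessageGenerator att e) {k : ℕ → ℕ}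
    (R : QPT (fun _ => noOracle) k G.m) (n : ℕ) (Φ : (G.iface att.genOracles n).Impl)
    (ρ : QMat (G.inLen n)) :
    ((M.blank R).circ n).channel Φ ρ = challenge ((M.circ n).channel Φ ρ) false :=
  Circuit.channel_resetFst _ _ _

theorem answerProb_blank (M : G.MessageGenerator att e) (D : G.Adversary att e u) {k : ℕ → ℕ}
    (R : QPT (fun _ => noOracle) k G.m) (n : ℕ) (y : List Bool) :
    answerProb (M.blank R) D n true y = answerProb M D n false y := by
  simp only [answerProb, ← channel_blank M R]
  simp only [challenge]

/-- Resetting the message changes neither the reduced state on `E` nor, branch by branch, the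
measurement results; the simulator cannot notice it. -/
theorem idealSuccess_constPair_blank (M : G.MessageGenerator att e)
    (S : G.Simulator att e u) {k : ℕ → ℕ} (R : QPT (fun _ => noOracle) k G.m) (n : ℕ) :
    idealSuccess (constPair (M.blank R)) S n = idealSuccess (constPair M) S n := by
  rw [idealSuccess, idealSuccess]
  congr 1
  funext ek dk
  refine Eq.trans ?_ ((M.circ n).sum_resetFst _)
  refine Finset.sum_congr rfl fun x _ => ?_
  have h := (Circuit.run_resetFst (M.circ n) (G.impl att.genOracles n ek dk) x
    (ketbra (G.input n ek)))
  have h := (congrArg traceFst h).trans (traceFst_zeroState_tensor _)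
  refine congrArg₂ (fun σ y => outProb ((S.circ n).channel (G.impl att.oracles n ek dk) σ) y) h ?_
  exact (BoolCircuit.eval_constTrue List.length_ofFn).trans
    (BoolCircuit.eval_constTrue List.length_ofFn).symm

theorem Valid.indPrime_of_sem3 (hG : G.Valid) (h : G.SEM3 att) : G.INDPrime att := by
  intro e u M D
  obtain ⟨k, ⟨R⟩⟩ := hG.decUniform
  -- The simulator precedes the pair in the quantifier order; using this one `S` for both pairs
  -- makes the ideal terms cancel.
  obtain ⟨u', S, hS⟩ := h e u D
  obtain ⟨ε₁, hε₁, h₁⟩ := hS (constPair M)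
  obtain ⟨ε₀, hε₀, h₀⟩ := hS (constPair (M.blank R))
  refine ⟨fun n => (1 / 2 : ℝ) * (ε₁ n + ε₀ n), (hε₁.add hε₀).const_mul _, fun n => ?_⟩
  have h₁ := (abs_le.1 (h₁ n)).2
  have h₀ := (abs_le.1 (h₀ n)).1
  have hD := hG.answerProb_add_le M D n
  rw [hG.realSuccess_constPair] at h₁
  rw [hG.realSuccess_constPair, answerProb_blank, idealSuccess_constPair_blank] at h₀
  rw [guessProb_eq]
  linarith

end Game

/-! ### Encryption schemes -/

theorem outProb_keys_nonneg {u : ℕ → ℕ} (A : QPT (fun _ => noOracle) (fun n => n) u) (n : ℕ)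
    (y : List Bool) : 0 ≤ outProb (A.map n (ketbra fun _ => true)) y :=
  outProb_nonneg ((A.isChannel_map n).toIsCP.apply (posSemidef_ketbra _)) y

theorem sum_outProb_keys_le {u : ℕ → ℕ} (A : QPT (fun _ => noOracle) (fun n => n) u) (n : ℕ)
    {ι : Type} [Fintype ι] {y : ι → List Bool} (hy : Function.Injective y) :
    ∑ i, outProb (A.map n (ketbra fun _ => true)) (y i) ≤ 1 := by
  refine (sum_outProb_le ((A.isChannel_map n).toIsCP.apply (posSemidef_ketbra _)) _ hy).trans_eq ?_
  rw [(A.isChannel_map n).trace_eq, trace_ketbra, Complex.one_re]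

/-- Both parts of a key string have fixed length, so the concatenation determines the pair, and key
probabilities sum to at most one. -/
theorem QPKE.valid_game (E : QPKE) : E.game.Valid where
  decUniform := ⟨_, ⟨E.dec⟩⟩
  prob_nonneg n ek dk := outProb_keys_nonneg E.keyGen n _
  sum_prob_le n := by
    rw [← Fintype.sum_prod_type']
    refine sum_outProb_keys_le E.keyGen n
      (y := fun x : Bits (E.pkLen n) × Bits n => List.ofFn x.1 ++ List.ofFn x.2) ?_
    rintro ⟨p, s⟩ ⟨p', s'⟩ h
    obtain ⟨h₁, h₂⟩ := List.append_inj h (by simp)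
    exact Prod.ext (List.ofFn_injective h₁) (List.ofFn_injective h₂)
  enc n ek := (E.enc.isChannel_map n).comp (isChannel_ketbra_tensor ek)
  dec n dk := (E.dec.isChannel_map n).comp (isChannel_ketbra_tensor dk)

/-- Pairs of different keys have probability zero, so the double sum reduces to the diagonal. -/
theorem QSKE.valid_game (E : QSKE) : E.game.Valid where
  decUniform := ⟨_, ⟨E.dec⟩⟩
  prob_nonneg := fun n (ek dk : Bits n) => by
    change (0 : ℝ) ≤ if ek = dk then
      outProb (E.keyGen.map n (ketbra fun _ => true)) (List.ofFn ek) else 0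
    split_ifs
    exacts [outProb_keys_nonneg E.keyGen n _, le_rfl]
  sum_prob_le n := by
    refine le_trans (le_of_eq (Finset.sum_congr rfl fun k _ => ?_))
      (sum_outProb_keys_le E.keyGen n List.ofFn_injective)
    exact Finset.sum_ite_eq Finset.univ k _ |>.trans (if_pos (Finset.mem_univ k))
  enc n ek := (E.enc.isChannel_map n).comp (isChannel_ketbra_tensor ek)
  dec n dk := (E.dec.isChannel_map n).comp (isChannel_ketbra_tensor dk)

end QEnc

theorem mainTheorem8 :
    (∀ (E : QEnc.QPKE) (att : QEnc.Attack), E.SEM3Secure att → E.INDPrimeSecure att) ∧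
      (∀ (E : QEnc.QSKE) (att : QEnc.Attack), E.SEM3Secure att → E.INDPrimeSecure att) :=
  ⟨fun E _ h => E.valid_game.indPrime_of_sem3 h, fun E _ h => E.valid_game.indPrime_of_sem3 h⟩
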